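/- Identify $\mathbb{R}^3$ with the pure quaternions, $x=(x_1,x_2,x_3)\leftrightarrow x_1\mathbf i+x_2\mathbf j+x_3\mathbf k$. Let $m$ be Lebesgue measure on $\mathbb{R}^3$, let $f(x)=(2\pi)^{-3/2}e^{-|x|^2/2}$, and let $d\mu=f\,dm$. For quaternion-valued functions put $\langle u,w\rangle=\int_{\mathbb{R}^3}\overline{u(z)}\,w(z)\,d\mu(z)$. Let $P_0,P_1,P_2,\dots$ be the monic orthogonal polynomials in the pure quaternion variable $z$ (finite sums $\sum_k z^k a_k$ with quaternion coefficients $a_k$), obtained from $1,z,z^2,\dots$ by the Gram–Schmidt process for this scalar product, and let $h_k=\langle P_k,P_k\rangle$. Fix one of the two indexings $N_n=n$ (for all $n$) or $N_n=n+1$ (for all $n$), and define the quaternion kernel $$K_n(x,y)=\sum_{k=0}^{N_n-1}\frac{P_k(x)\,\overline{P_k(y)}}{h_k}.$$ The 3D Ginibre field with kernel $K_n$ is a simple random point field on $\mathbb{R}^3$ whose correlation functions with respect to $\mu$ are, for all $k$, $R_k(x_1,\dots,x_k)=\mathrm{Det}_M[K_n(x_i,x_j)]_{1\le i,j\le k}$,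 where $\mathrm{Det}_M$ is the Dyson–Moore determinant of self-dual quaternion matrices. Let $\rho_n(x)=R_1(x)f(x)$ be its one-point density with respect to Lebesgue measure. (1) For every $n$, $\rho_n$ is continuous, and for every random point field $\mathcal X$ that is determinantal with kernel $K_n$ and background measure $\mu$, $\rho_n$ is the unique continuous function $\rho\ge 0$ such that $\mathbb{E}\,\mathcal X(A)=\int_A\rho\,dm$ for all Borel sets $A\subset\mathbb{R}^3$. (2) For every pure unit quaternion $u$ and every real $s>0$, $$\lim_{n\to\infty}2\sqrt n\,\rho_n\big(2\sqrt n\,u s\big)=\begin{cases}\dfrac{1}{(2\pi)^2}\,\dfrac{\sqrt{1-s^2}}{s^2}, & s<1,\\[2mm] 0, & s>1.\end{cases}$$ -/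

import Mathlib

open MeasureTheory Filter Topology
open scoped Quaternion

namespace GinibreThree

noncomputable section

/-- The space `ℝ³` of pure quaternions, with its Euclidean norm and Lebesgue measure `volume`. -/
abbrev E3 : Type := EuclideanSpace ℝ (Fin 3)

/-- The identification of `(x₁, x₂, x₃)` with the pure quaternion `x₁ i + x₂ j + x₃ k`. -/
def toPure (x : E3) : ℍ[ℝ] := ⟨0, x 0, x 1, x 2⟩

/-- The Gaussian density `(2π)^(-3/2) exp (-|x|² / 2)`. -/
def gaussDensity (x : E3) : ℝ :=
  (2 * Real.pi) ^ (-(3 / 2) : ℝ) * Real.exp (-‖x‖ ^ 2 / 2)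

/-- The background measure: the standard Gaussian measure on `ℝ³`. -/
def gaussMeasure : Measure E3 :=
  volume.withDensity fun x => ENNReal.ofReal (gaussDensity x)

/-- The quaternion-valued scalar product `⟨u, w⟩ = ∫ ū w dμ`, linear over right
multiplication by quaternions in the second argument. -/
def scalarProd (u w : E3 → ℍ[ℝ]) : ℍ[ℝ] :=
  ∫ z, star (u z) * w z ∂gaussMeasure

/-- The monic orthogonal polynomials `P n` in a pure quaternion variable (finite sums
`∑ zᵏ aₖ` with quaternion coefficients on the right), produced from `1, z, z², …` by the
Gram-Schmidt process without normalization: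
`P n = zⁿ - ∑_{k < n} P k · ⟨P k, P k⟩⁻¹ ⟨P k, zⁿ⟩`. -/
def orthoPoly : ℕ → E3 → ℍ[ℝ]
  | n => fun z => toPure z ^ n -
      ∑ k : Fin n, orthoPoly k z *
        ((scalarProd (orthoPoly k) (orthoPoly k))⁻¹ *
          scalarProd (orthoPoly k) (fun w => toPure w ^ n))
termination_by n => n
decreasing_by all_goals exact k.2

/-- The squared norm `h k = ‖P k‖² = ⟨P k, P k⟩`, which is a real number. -/
def normConst (k : ℕ) : ℝ := (scalarProd (orthoPoly k) (orthoPoly k)).re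

/-- The quaternion kernel with `N` terms, `∑_{k < N} P k (x) * conj (P k (y)) / h k`. -/
def kernel (N : ℕ) (x y : E3) : ℍ[ℝ] :=
  ∑ k ∈ Finset.range N, (normConst k)⁻¹ • (orthoPoly k x * star (orthoPoly k y))

/-- The product `A i (σ i) * A (σ i) (σ² i) * ⋯ * A (σ⁻¹ i) i` of the entries of `A` along
the cycle of `σ` that contains `i`, started at `i`. -/
def cycleProd {k : ℕ} (A : Matrix (Fin k) (Fin k) ℍ[ℝ]) (σ : Equiv.Perm (Fin k)) (i : Fin k) :
    ℍ[ℝ] :=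
  ((List.range (Function.minimalPeriod σ i)).map
    fun j => A ((σ ^ j) i) ((σ ^ (j + 1)) i)).prod

open scoped Classical in
/-- The Dyson-Moore determinant of a self-dual quaternion matrix: the sum over all permutations
of the sign times the product, over all cycles (fixed points included), of the scalar part of
the product of the entries along the cycle. Each cycle is started at its smallest element; the
scalar part does not depend on this choice. -/
def mooreDet {k : ℕ} (A : Matrix (Fin k) (Fin k) ℍ[ℝ]) : ℝ :=
  ∑ σ : Equiv.Perm (Fin k), ((Equiv.Perm.sign σ : ℤ) : ℝ) *
    ∏ i ∈ Finset.univ.filter (fun i : Fin k => ∀ j, σ.SameCycle i j → i ≤ j),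
      (cycleProd A σ i).re

/-- A simple random point field on `ℝ³`: a random integer-valued Radon measure, almost surely
without multiple points. -/
structure IsPointField {Ω : Type*} [MeasurableSpace Ω] (P : Measure Ω)
    (X : Ω → Measure E3) : Prop where
  measurable : Measurable X
  finite_on_compacts : ∀ ω, IsFiniteMeasureOnCompacts (X ω)
  integer_valued : ∀ ω (A : Set E3), MeasurableSet A → ∃ m : ℕ∞, X ω A = (m : ENNReal)
  simple : ∀ᵐ ω ∂P, ∀ x, X ω {x} ≤ 1

/-- `R` is a `k`-point correlation function of the point field `X` relative to the background
measure `μ`: `R` is nonnegative and locally integrable, and for disjoint Borel sets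
`A₁, …, Aₘ` and nonnegative integers `κ₁ + ⋯ + κₘ = k`,
`𝔼 ∏ᵢ X(Aᵢ) (X(Aᵢ) - 1) ⋯ (X(Aᵢ) - κᵢ + 1) = ∫_{A₁^κ₁ × ⋯ × Aₘ^κₘ} R dμᵏ`. -/
structure IsCorrelationFunction {Ω : Type*} [MeasurableSpace Ω] (P : Measure Ω)
    (X : Ω → Measure E3) (μ : Measure E3) (k : ℕ) (R : (Fin k → E3) → ℝ) : Prop where
  nonneg : ∀ x, 0 ≤ R x
  locallyIntegrable : LocallyIntegrable R (Measure.pi fun _ => μ)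
  factorial_moment : ∀ (m : ℕ) (A : Fin m → Set E3) (κ : Fin m → ℕ) (hκ : ∑ i, κ i = k),
    (∀ i, MeasurableSet (A i)) → Pairwise (fun i j => Disjoint (A i) (A j)) →
    ∫⁻ ω, ∏ i, ∏ j ∈ Finset.range (κ i), (X ω (A i) - (j : ENNReal)) ∂P =
      ∫⁻ x in {x : Fin k → E3 |
          ∀ (i : Fin m) (j : Fin (κ i)), x (Fin.cast hκ (finSigmaFinEquiv ⟨i, j⟩)) ∈ A i},
        ENNReal.ofReal (R x) ∂(Measure.pi fun _ => μ)

/-- The determinant `Det_M [K (x i) (x j)]`. -/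
def kernelDet (K : E3 → E3 → ℍ[ℝ]) (k : ℕ) (x : Fin k → E3) : ℝ :=
  mooreDet (Matrix.of fun i j => K (x i) (x j))

/-- `X` is a determinantal point field with quaternion kernel `K` and background measure `μ`. -/
structure IsDeterminantalField {Ω : Type*} [MeasurableSpace Ω] (P : Measure Ω)
    (X : Ω → Measure E3) (μ : Measure E3) (K : E3 → E3 → ℍ[ℝ]) : Prop where
  isPointField : IsPointField P X
  correlation : ∀ k, IsCorrelationFunction P X μ k (kernelDet K k)

/-- `ρ` is a one-point density of the point field `X` with respect to Lebesgue measure: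
the expected number of points in any Borel set `A` is `∫_A ρ(x) dx`. -/
structure IsOnePointDensity {Ω : Type*} [MeasurableSpace Ω] (P : Measure Ω)
    (X : Ω → Measure E3) (ρ : E3 → ℝ) : Prop where
  nonneg : ∀ x, 0 ≤ ρ x
  intensity : ∀ A, MeasurableSet A →
    ∫⁻ ω, X ω A ∂P = ∫⁻ x in A, ENNReal.ofReal (ρ x)

/-- The density with respect to Lebesgue measure of the field with kernel `kernel N`: its first
correlation function times the density of the background measure. -/
def fieldDensity (N : ℕ) (x : E3) : ℝ :=
  kernelDet (kernel N) 1 (fun _ => x) * gaussDensity x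

end

end GinibreThree

open MeasureTheory Filter Topology
open scoped Quaternion

namespace GinibreThree

noncomputable section

open scoped Polynomial

/-! ### Pure quaternions -/

/-! A pure quaternion satisfies `star z = -z` and `z ^ 2 = -|z| ^ 2`, so all Gaussian moments of `z`
are real and Gram–Schmidt stays inside real polynomials. The `P_k` obey a real three-term recurrence
(`monicPoly`, `orthoPoly_eq_aeval`). With `r = |z|`, the radial weight is `r ^ 2 * exp (-r ^ 2 /
2)`, so `r * P_{2m}` is up to sign the odd Hermite polynomial `He_{2m+1}`, and the recurrence then
gives `P_{2m+1}` (`orthoPoly_eq_herm`). After normalization the sum of `‖P_k‖ ^ 2 / h_k` telescopes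
to the Hermite kernel on the diagonal, divided by `r ^ 2`, up to one negligible term
(`exists_fieldDensity_eq`).

By Christoffel–Darboux the Hermite kernel with `M` terms is, up to `φ ^ 2 / 2`, the energy `E = φ' ^
2 + q φ ^ 2` of the Hermite function `φ'' = -q φ`, `q = M + 1/2 - x ^ 2 / 4` (`sum_hermFun_sq`). No
Plancherel–Rotach asymptotics are needed: `E / √q` is an adiabatic invariant, nearly constant away
from the turning point (`energy_adiabatic`), and at the origin it tends to `1 / π` by Wallis'
product (`tendsto_hermEnergy_zero`). Hence for `s < 1` and `x = 2√n s`, `E ≈ √n √(1 - s ^ 2) / π`,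
and dividing by `2π x ^ 2` gives the limit. For `s > 1`, `E` decreases on `x ≥ 0`, so it is
dominated by its values just inside the edge, which are `o(√n)`. A bounded shift of the index, in
particular the choice `N_n = n + c`, does not affect the leading order.

For part (1), the first factorial moment is the intensity, and continuous densities that agree
almost everywhere agree. -/

@[simp] lemma toPure_re (x : E3) : (toPure x).re = 0 := rfl

@[simp] lemma toPure_imI (x : E3) : (toPure x).imI = x 0 := rfl

@[simp] lemma toPure_imJ (x : E3) : (toPure x).imJ = x 1 := rfl

@[simp] lemma toPure_imK (x : E3) : (toPure x).imK = x 2 := rfl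

lemma star_toPure (x : E3) : star (toPure x) = -toPure x := by
  ext <;> simp

lemma toPure_neg (x : E3) : toPure (-x) = -toPure x := by
  ext <;> simp

lemma toPure_mul_self (x : E3) : toPure x * toPure x = ((-‖x‖ ^ 2 : ℝ) : ℍ[ℝ]) := by
  have h : ‖x‖ ^ 2 = x 0 ^ 2 + x 1 ^ 2 + x 2 ^ 2 := by
    rw [EuclideanSpace.norm_sq_eq]
    simp [Fin.sum_univ_three]
  rw [h]
  ext <;> simp only [Quaternion.re_mul, Quaternion.imI_mul, Quaternion.imJ_mul,
    Quaternion.imK_mul, Quaternion.re_coe, Quaternion.imI_coe, Quaternion.imJ_coe,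
    Quaternion.imK_coe, toPure_re, toPure_imI, toPure_imJ, toPure_imK] <;> ring

lemma norm_toPure (x : E3) : ‖toPure x‖ = ‖x‖ := by
  have h : ‖toPure x‖ * ‖toPure x‖ = ‖x‖ * ‖x‖ := by
    rw [← norm_mul, toPure_mul_self, Quaternion.norm_coe, norm_neg, norm_pow, norm_norm, sq]
  nlinarith [norm_nonneg x, norm_nonneg (toPure x)]

lemma toPure_pow_even (x : E3) (i : ℕ) :
    toPure x ^ (2 * i) = (((-1) ^ i * ‖x‖ ^ (2 * i) : ℝ) : ℍ[ℝ]) := by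
  rw [pow_mul, sq, toPure_mul_self, ← Quaternion.coe_pow, neg_pow, ← pow_mul]

lemma continuous_toPure : Continuous toPure := by
  have h : toPure = fun x : E3 => (x 0) • (⟨0, 1, 0, 0⟩ : ℍ[ℝ]) + (x 1) • (⟨0, 0, 1, 0⟩ : ℍ[ℝ])
      + (x 2) • (⟨0, 0, 0, 1⟩ : ℍ[ℝ]) := by
    funext x
    ext <;> simp
  rw [h]
  have c (i : Fin 3) : Continuous fun x : E3 => x i := by fun_prop
  exact (((c 0).smul continuous_const).add ((c 1).smul continuous_const)).add
    ((c 2).smul continuous_const)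

/-! ### Radial moments of the Gaussian measure -/

lemma continuous_gaussDensity : Continuous gaussDensity := by
  unfold gaussDensity
  fun_prop

lemma gaussDensity_pos (x : E3) : 0 < gaussDensity x := by
  unfold gaussDensity
  positivity

lemma measurable_ofReal_gaussDensity :
    Measurable fun x : E3 => ENNReal.ofReal (gaussDensity x) :=
  continuous_gaussDensity.measurable.ennreal_ofReal

lemma integral_gaussMeasure {F : Type*} [NormedAddCommGroup F] [NormedSpace ℝ F] (g : E3 → F) :
    ∫ x, g x ∂gaussMeasure = ∫ x, gaussDensity x • g x := by
  unfold gaussMeasure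
  rw [integral_withDensity_eq_integral_toReal_smul measurable_ofReal_gaussDensity
    (ae_of_all _ fun _ => ENNReal.ofReal_lt_top)]
  simp only [ENNReal.toReal_ofReal (gaussDensity_pos _).le]

lemma integrable_gaussMeasure_iff {F : Type*} [NormedAddCommGroup F] [NormedSpace ℝ F]
    {g : E3 → F} :
    Integrable g gaussMeasure ↔ Integrable (fun x => gaussDensity x • g x) := by
  unfold gaussMeasure
  rw [integrable_withDensity_iff_integrable_smul' measurable_ofReal_gaussDensity
    (ae_of_all _ fun _ => ENNReal.ofReal_lt_top)]
  simp only [ENNReal.toReal_ofReal (gaussDensity_pos _).le]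

lemma finrank_E3 : Module.finrank ℝ E3 = 3 := by simp

lemma integrable_norm_pow (k : ℕ) : Integrable (fun x : E3 => ‖x‖ ^ k) gaussMeasure := by
  rw [integrable_gaussMeasure_iff]
  have h := integrable_fun_norm_addHaar (volume : Measure E3)
    (f := fun y : ℝ => (2 * Real.pi) ^ (-(3 / 2) : ℝ) * Real.exp (-y ^ 2 / 2) * y ^ k)
  refine h.2 ?_
  rw [finrank_E3]
  have h2 := (integrableOn_rpow_mul_exp_neg_mul_sq (b := 1 / 2) (by norm_num)
    (s := ((k + 2 : ℕ) : ℝ)) (by have := Nat.cast_nonneg (α := ℝ) (k + 2); linarith)).const_mul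
      ((2 * Real.pi) ^ (-(3 / 2) : ℝ))
  refine IntegrableOn.congr_fun h2 (fun y _ => ?_) measurableSet_Ioi
  simp only [Real.rpow_natCast, smul_eq_mul]
  rw [show -(1 / 2) * y ^ 2 = -y ^ 2 / 2 by ring]
  ring

/-- Polar coordinates. The sphere constant is left unevaluated because only ratios of moments are
used. -/
lemma integral_norm_pow (k : ℕ) : ∫ x : E3, ‖x‖ ^ k ∂gaussMeasure =
    3 * (volume : Measure E3).real (Metric.ball 0 1) * ((2 * Real.pi) ^ (-(3 / 2) : ℝ) *
      ∫ y in Set.Ioi (0 : ℝ), y ^ ((k + 2 : ℕ) : ℝ) * Real.exp (-(1 / 2) * y ^ (2 : ℝ))) := by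
  rw [integral_gaussMeasure]
  have h := integral_fun_norm_addHaar (volume : Measure E3)
    (fun y : ℝ => (2 * Real.pi) ^ (-(3 / 2) : ℝ) * Real.exp (-y ^ 2 / 2) * y ^ k)
  rw [finrank_E3] at h
  refine h.trans ?_
  rw [← integral_const_mul, nsmul_eq_mul, smul_eq_mul, ← mul_assoc]
  congr 1
  refine setIntegral_congr_fun measurableSet_Ioi fun y _ => ?_
  simp only [Real.rpow_natCast, smul_eq_mul, Real.rpow_two]
  rw [show -(1 / 2) * y ^ 2 = -y ^ 2 / 2 by ring]
  ring

lemma integral_norm_pow_add_two (k : ℕ) :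
    ∫ x : E3, ‖x‖ ^ (k + 2) ∂gaussMeasure = (k + 3) * ∫ x : E3, ‖x‖ ^ k ∂gaussMeasure := by
  have hk := Nat.cast_nonneg (α := ℝ) k
  rw [integral_norm_pow, integral_norm_pow,
    integral_rpow_mul_exp_neg_mul_rpow (by norm_num)
      (by push_cast; linarith) (by norm_num),
    integral_rpow_mul_exp_neg_mul_rpow (by norm_num)
      (by push_cast; linarith) (by norm_num)]
  push_cast
  rw [show ((k : ℝ) + 2 + 2 + 1) / 2 = (k + 2 + 1) / 2 + 1 by ring,
    show -((k : ℝ) + 2 + 2 + 1) / 2 = -(k + 2 + 1) / 2 - 1 by ring,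
    Real.Gamma_add_one (by positivity), Real.rpow_sub_one (by norm_num)]
  ring

instance : IsProbabilityMeasure gaussMeasure := by
  constructor
  unfold gaussMeasure
  rw [withDensity_apply _ MeasurableSet.univ, Measure.restrict_univ,
    ← ofReal_integral_eq_lintegral_ofReal _ (ae_of_all _ fun x => (gaussDensity_pos x).le)]
  · rw [← ENNReal.ofReal_one]
    congr 1
    unfold gaussDensity
    have h := GaussianFourier.integral_rexp_neg_mul_sq_norm (V := E3) (b := 1 / 2) (by norm_num)
    rw [finrank_E3] at h
    rw [integral_const_mul]
    have h' : ∫ x : E3, Real.exp (-‖x‖ ^ 2 / 2) = (2 * Real.pi) ^ (3 / 2 : ℝ) := by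
      rw [show (2 * Real.pi) = Real.pi / (1 / 2) by ring]
      convert h using 2
      · funext x
        congr 1
        ring
      · norm_num
    rw [h', ← Real.rpow_add (by positivity)]
    norm_num
  · simpa using integrable_gaussMeasure_iff.1 (integrable_norm_pow 0)

/-! ### Integrals of polynomials in a pure quaternion variable -/

lemma continuous_aeval_toPure (q : ℝ[X]) : Continuous fun z => Polynomial.aeval (toPure z) q := by
  simp only [Polynomial.aeval_eq_sum_range]
  refine continuous_finsetSum _ fun i _ => ?_
  have h : Continuous fun z => toPure z ^ i := continuous_toPure.pow i
  exact h.const_smul (q.coeff i)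

lemma integrable_aeval_toPure (q : ℝ[X]) :
    Integrable (fun z => Polynomial.aeval (toPure z) q) gaussMeasure := by
  induction q using Polynomial.induction_on' with
  | add p q hp hq => simp only [map_add]; exact hp.add hq
  | monomial n a =>
    refine ((integrable_norm_pow n).const_mul ‖a‖).mono'
      (continuous_aeval_toPure _).aestronglyMeasurable (ae_of_all _ fun z => ?_)
    rw [Polynomial.aeval_monomial, norm_mul, norm_pow, norm_toPure, norm_algebraMap']

/-- The integral over the Gaussian measure of a real polynomial in the pure quaternion variable. -/
def polyIntegral : ℝ[X] →ₗ[ℝ] ℍ[ℝ] where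
  toFun q := ∫ z, Polynomial.aeval (toPure z) q ∂gaussMeasure
  map_add' p q := by
    simp only [map_add]
    exact integral_add (integrable_aeval_toPure p) (integrable_aeval_toPure q)
  map_smul' a q := by
    simp only [map_smul, RingHom.id_apply]
    exact integral_smul a _

lemma polyIntegral_apply (q : ℝ[X]) :
    polyIntegral q = ∫ z, Polynomial.aeval (toPure z) q ∂gaussMeasure := rfl

/-- The Gaussian measure is invariant under `z ↦ -z`. -/
lemma polyIntegral_comp_neg_X (q : ℝ[X]) :
    polyIntegral (q.comp (-Polynomial.X)) = polyIntegral q := by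
  have h : ∀ z, Polynomial.aeval (toPure z) (q.comp (-Polynomial.X))
      = Polynomial.aeval (toPure (-z)) q := by
    intro z
    rw [Polynomial.aeval_comp, map_neg, Polynomial.aeval_X, toPure_neg]
  simp only [polyIntegral_apply, h, integral_gaussMeasure]
  rw [← integral_neg_eq_self]
  refine integral_congr_ae (ae_of_all _ fun z => ?_)
  simp [gaussDensity]

lemma polyIntegral_one : polyIntegral 1 = 1 := by
  simp [polyIntegral_apply]

lemma polyIntegral_X_pow_even (i : ℕ) : polyIntegral (Polynomial.X ^ (2 * i)) =
    (((-1) ^ i * ∫ x : E3, ‖x‖ ^ (2 * i) ∂gaussMeasure : ℝ) : ℍ[ℝ]) := by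
  simp only [polyIntegral_apply, map_pow, Polynomial.aeval_X, toPure_pow_even]
  have h : ∀ r : ℝ, (r : ℍ[ℝ]) = r • (1 : ℍ[ℝ]) := fun r => by
    rw [← Quaternion.coe_one, ← Quaternion.coe_smul, smul_eq_mul, mul_one]
  rw [h, ← integral_const_mul, ← integral_smul_const]
  simp only [h]

lemma polyIntegral_X_pow_even_succ (i : ℕ) : polyIntegral (Polynomial.X ^ (2 * (i + 1))) =
    (-(2 * i + 3) : ℝ) • polyIntegral (Polynomial.X ^ (2 * i)) := by
  rw [polyIntegral_X_pow_even, polyIntegral_X_pow_even, mul_add, mul_one,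
    integral_norm_pow_add_two, ← Quaternion.coe_smul]
  congr 1
  push_cast
  rw [smul_eq_mul]
  ring

/-! ### The orthogonal polynomials as real polynomials in the pure quaternion variable -/

lemma star_aeval (w : ℍ[ℝ]) (p : ℝ[X]) :
    star (Polynomial.aeval w p) = Polynomial.aeval (star w) p := by
  simp only [Polynomial.aeval_eq_sum_range, star_sum, Quaternion.star_smul, star_pow]

lemma scalarProd_aeval (p q : ℝ[X]) :
    scalarProd (fun z => Polynomial.aeval (toPure z) p) (fun z => Polynomial.aeval (toPure z) q) =
      polyIntegral (p.comp (-Polynomial.X) * q) := by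
  unfold scalarProd
  rw [polyIntegral_apply]
  refine integral_congr_ae (ae_of_all _ fun z => ?_)
  simp only [map_mul, Polynomial.aeval_comp, map_neg, Polynomial.aeval_X, star_aeval, star_toPure]

/-- The coefficients of the three-term recurrence of the orthogonal polynomials. -/
def recCoeff (k : ℕ) : ℝ := if Even k then k else k + 2

/-- The orthogonal polynomials, defined by their three-term recurrence. -/
def monicPoly : ℕ → ℝ[X]
  | 0 => 1
  | 1 => Polynomial.X
  | k + 2 => Polynomial.X * monicPoly (k + 1) + Polynomial.C (recCoeff (k + 1)) * monicPoly k

lemma monicPoly_even_add_two (m : ℕ) : monicPoly (2 * (m + 1)) =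
    Polynomial.X * monicPoly (2 * m + 1) + (2 * m + 3 : ℝ) • monicPoly (2 * m) := by
  rw [mul_add, mul_one, monicPoly, recCoeff, if_neg (by simp), Polynomial.smul_eq_C_mul]
  push_cast
  ring_nf

lemma monicPoly_odd_add_two (m : ℕ) : monicPoly (2 * (m + 1) + 1) =
    Polynomial.X * monicPoly (2 * (m + 1)) + (2 * m + 2 : ℝ) • monicPoly (2 * m + 1) := by
  rw [show 2 * (m + 1) + 1 = (2 * m + 1) + 2 by ring, monicPoly, recCoeff,
    if_pos ⟨m + 1, by ring⟩, Polynomial.smul_eq_C_mul, show 2 * m + 1 + 1 = 2 * (m + 1) by ring]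
  push_cast
  ring_nf

lemma monicPoly_monic_natDegree (k : ℕ) :
    (monicPoly k).Monic ∧ (monicPoly k).natDegree = k := by
  induction k using Nat.twoStepInduction with
  | zero => simp [monicPoly]
  | one => simp [monicPoly, Polynomial.monic_X]
  | more k h0 h1 =>
    have hX : (Polynomial.X * monicPoly (k + 1)).Monic := Polynomial.monic_X.mul h1.1
    have hd : (Polynomial.X * monicPoly (k + 1)).natDegree = k + 2 := by
      rw [Polynomial.natDegree_X_mul h1.1.ne_zero, h1.2]
    have hlt : (Polynomial.C (recCoeff (k + 1)) * monicPoly k).natDegree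
        < (Polynomial.X * monicPoly (k + 1)).natDegree := by
      rw [hd]
      exact (Polynomial.natDegree_C_mul_le _ _).trans_lt (by omega)
    rw [monicPoly]
    exact ⟨hX.add_of_left (Polynomial.degree_lt_degree hlt),
      (Polynomial.natDegree_add_eq_left_of_natDegree_lt hlt).trans hd⟩

lemma monicPoly_comp_neg_X (k : ℕ) :
    (monicPoly k).comp (-Polynomial.X) = ((-1) ^ k : ℝ) • monicPoly k := by
  induction k using Nat.twoStepInduction with
  | zero => simp [monicPoly]
  | one => simp [monicPoly]
  | more k h0 h1 =>
    simp only [monicPoly, Polynomial.add_comp, Polynomial.mul_comp, Polynomial.X_comp,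
      Polynomial.C_comp, h0, h1, Polynomial.smul_eq_C_mul, pow_succ, map_mul, map_neg, map_one]
    ring

lemma cast_descFactorial_succ (i m : ℕ) :
    (i.descFactorial (m + 1) : ℝ) = (i - m) * i.descFactorial m := by
  rw [Nat.descFactorial_succ]
  rcases le_or_gt m i with h | h
  · push_cast [Nat.cast_sub h]
    ring
  · simp [Nat.descFactorial_of_lt h]

/-- This carries the orthogonality: the falling factorial vanishes exactly for `i < m`. Both
parities are proved together because each step of the recurrence uses the other one. -/
lemma polyIntegral_monicPoly_mul_X_pow (m : ℕ) : ∀ i : ℕ,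
    polyIntegral (monicPoly (2 * m) * Polynomial.X ^ (2 * i)) =
      ((-2) ^ m * i.descFactorial m : ℝ) • polyIntegral (Polynomial.X ^ (2 * i)) ∧
    polyIntegral (monicPoly (2 * m + 1) * Polynomial.X ^ (2 * i + 1)) =
      ((-2) ^ m * i.descFactorial m * -(2 * i + 3) : ℝ) •
        polyIntegral (Polynomial.X ^ (2 * i)) := by
  induction m with
  | zero =>
    intro i
    have h : (Polynomial.X * Polynomial.X ^ (2 * i + 1) : ℝ[X]) = Polynomial.X ^ (2 * (i + 1)) := by
      ring
    simp only [monicPoly, one_mul, h, polyIntegral_X_pow_even_succ]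
    simp
  | succ m ih =>
    have key : ∀ i : ℕ, polyIntegral (monicPoly (2 * (m + 1)) * Polynomial.X ^ (2 * i)) =
        ((-2) ^ (m + 1) * i.descFactorial (m + 1) : ℝ) •
          polyIntegral (Polynomial.X ^ (2 * i)) := by
      intro i
      have h : monicPoly (2 * (m + 1)) * Polynomial.X ^ (2 * i) =
          monicPoly (2 * m + 1) * Polynomial.X ^ (2 * i + 1) +
          (2 * m + 3 : ℝ) • (monicPoly (2 * m) * Polynomial.X ^ (2 * i)) := by
        rw [monicPoly_even_add_two, Polynomial.smul_eq_C_mul, Polynomial.smul_eq_C_mul]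
        ring
      rw [h, map_add, map_smul, (ih i).1, (ih i).2, smul_smul, ← add_smul,
        cast_descFactorial_succ]
      congr 1
      ring
    intro i
    refine ⟨key i, ?_⟩
    have h : monicPoly (2 * (m + 1) + 1) * Polynomial.X ^ (2 * i + 1) =
        monicPoly (2 * (m + 1)) * Polynomial.X ^ (2 * (i + 1)) +
        (2 * m + 2 : ℝ) • (monicPoly (2 * m + 1) * Polynomial.X ^ (2 * i + 1)) := by
      rw [monicPoly_odd_add_two, Polynomial.smul_eq_C_mul, Polynomial.smul_eq_C_mul]
      ring
    rw [h, map_add, map_smul, key, (ih i).2, polyIntegral_X_pow_even_succ, smul_smul, smul_smul,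
      ← add_smul, Nat.succ_descFactorial_succ, cast_descFactorial_succ]
    congr 1
    push_cast
    ring

lemma polyIntegral_monicPoly_mul_X_pow_of_odd {k j : ℕ} (h : Odd (k + j)) :
    polyIntegral (monicPoly k * Polynomial.X ^ j) = 0 := by
  have h1 := polyIntegral_comp_neg_X (monicPoly k * Polynomial.X ^ j)
  have h2 : (monicPoly k * Polynomial.X ^ j).comp (-Polynomial.X) =
      (-1 : ℝ) • (monicPoly k * Polynomial.X ^ j) := by
    rw [← h.neg_one_pow, Polynomial.mul_comp, monicPoly_comp_neg_X, Polynomial.X_pow_comp, neg_pow,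
      pow_add]
    simp only [Polynomial.smul_eq_C_mul, map_mul, map_pow, map_neg, map_one]
    ring
  rw [h2, map_smul, neg_one_smul, neg_eq_iff_add_eq_zero, ← two_smul ℝ] at h1
  exact (smul_eq_zero.1 h1).resolve_left two_ne_zero

lemma polyIntegral_monicPoly_mul_X_pow_of_lt {k j : ℕ} (h : j < k) :
    polyIntegral (monicPoly k * Polynomial.X ^ j) = 0 := by
  rcases Nat.even_or_odd' k with ⟨m, rfl | rfl⟩ <;> rcases Nat.even_or_odd' j with ⟨i, rfl | rfl⟩
  · rw [(polyIntegral_monicPoly_mul_X_pow m i).1, Nat.descFactorial_of_lt (by omega)]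
    simp
  · exact polyIntegral_monicPoly_mul_X_pow_of_odd ⟨m + i, by ring⟩
  · exact polyIntegral_monicPoly_mul_X_pow_of_odd ⟨m + i, by ring⟩
  · rw [(polyIntegral_monicPoly_mul_X_pow m i).2, Nat.descFactorial_of_lt (by omega)]
    simp

lemma polyIntegral_monicPoly_mul_of_degree_lt {k : ℕ} {q : ℝ[X]} (h : q.degree < k) :
    polyIntegral (monicPoly k * q) = 0 := by
  rw [← Polynomial.sum_monomial_eq q, Polynomial.sum_def, Finset.mul_sum, map_sum]
  refine Finset.sum_eq_zero fun j hj => ?_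
  have hjk : j < k := by
    exact_mod_cast (Polynomial.le_degree_of_mem_supp j hj).trans_lt h
  rw [← Polynomial.smul_X_eq_monomial, mul_smul_comm, map_smul,
    polyIntegral_monicPoly_mul_X_pow_of_lt hjk, smul_zero]

lemma degree_monicPoly (k : ℕ) : (monicPoly k).degree = k := by
  rw [Polynomial.degree_eq_natDegree (monicPoly_monic_natDegree k).1.ne_zero,
    (monicPoly_monic_natDegree k).2]

lemma polyIntegral_monicPoly_mul_monicPoly {j k : ℕ} (h : j ≠ k) :
    polyIntegral (monicPoly j * monicPoly k) = 0 := by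
  rcases lt_or_gt_of_ne h with h | h
  · rw [mul_comm]
    exact polyIntegral_monicPoly_mul_of_degree_lt (by rw [degree_monicPoly]; exact_mod_cast h)
  · exact polyIntegral_monicPoly_mul_of_degree_lt (by rw [degree_monicPoly]; exact_mod_cast h)

lemma degree_X_pow_sub_monicPoly (k : ℕ) :
    (Polynomial.X ^ k - monicPoly k : ℝ[X]).degree < k := by
  have h := Polynomial.degree_sub_lt_left (p := (Polynomial.X ^ k : ℝ[X])) (q := monicPoly k)
    (by rw [degree_monicPoly, Polynomial.degree_X_pow]) (pow_ne_zero _ Polynomial.X_ne_zero)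
    (by rw [(monicPoly_monic_natDegree k).1.leadingCoeff, Polynomial.leadingCoeff_X_pow])
  rwa [Polynomial.degree_X_pow] at h

lemma polyIntegral_monicPoly_mul_self (k : ℕ) :
    polyIntegral (monicPoly k * monicPoly k) =
      polyIntegral (monicPoly k * Polynomial.X ^ k) := by
  have h := polyIntegral_monicPoly_mul_of_degree_lt (degree_X_pow_sub_monicPoly k)
  rw [mul_sub, map_sub, sub_eq_zero] at h
  exact h.symm

/-- The moment of `z ^ (2m)` is `(-1) ^ m * (2m+1)‼`, and `2 ^ m * m! * (2m+1)‼ = (2m+1)!`. -/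
lemma descFactorial_smul_polyIntegral (m : ℕ) :
    ((-2) ^ m * m.descFactorial m : ℝ) • polyIntegral (Polynomial.X ^ (2 * m)) =
      (((2 * m + 1).factorial : ℝ) : ℍ[ℝ]) := by
  induction m with
  | zero => simp [polyIntegral_one]
  | succ m ih =>
    rw [polyIntegral_X_pow_even_succ, smul_smul, Nat.succ_descFactorial_succ]
    have h : ((-2) ^ (m + 1) * ((m + 1) * m.descFactorial m : ℕ) * -(2 * m + 3) : ℝ) =
        ((2 * m + 2) * (2 * m + 3)) * ((-2) ^ m * m.descFactorial m) := by
      push_cast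
      ring
    rw [h, ← smul_smul, ih, ← Quaternion.coe_smul, smul_eq_mul]
    congr 1
    rw [show 2 * (m + 1) + 1 = (2 * m + 1) + 1 + 1 by ring, Nat.factorial_succ (2 * m + 1 + 1),
      Nat.factorial_succ (2 * m + 1)]
    push_cast
    ring

/-- The squared norms of the orthogonal polynomials. -/
def sqNorm (k : ℕ) : ℝ := if Even k then (k + 1).factorial else (k + 2) * k.factorial

lemma sqNorm_even (m : ℕ) : sqNorm (2 * m) = (2 * m + 1).factorial := by
  rw [sqNorm, if_pos (by simp)]

lemma sqNorm_odd (m : ℕ) : sqNorm (2 * m + 1) = (2 * m + 3) * (2 * m + 1).factorial := by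
  rw [sqNorm, if_neg (by simp)]
  push_cast
  ring

lemma sqNorm_pos (k : ℕ) : 0 < sqNorm k := by
  unfold sqNorm
  split_ifs <;> positivity

/-- Conjugation acts on pure quaternions as `z ↦ -z`, so by parity of `monicPoly` it costs only a
sign. -/
lemma scalarProd_monicPoly_left (k : ℕ) (q : ℝ[X]) :
    scalarProd (fun z => Polynomial.aeval (toPure z) (monicPoly k))
      (fun z => Polynomial.aeval (toPure z) q) =
      ((-1) ^ k : ℝ) • polyIntegral (monicPoly k * q) := by
  rw [scalarProd_aeval, monicPoly_comp_neg_X, smul_mul_assoc, map_smul]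

lemma scalarProd_monicPoly_self (k : ℕ) :
    scalarProd (fun z => Polynomial.aeval (toPure z) (monicPoly k))
      (fun z => Polynomial.aeval (toPure z) (monicPoly k)) = (sqNorm k : ℍ[ℝ]) := by
  rw [scalarProd_monicPoly_left, polyIntegral_monicPoly_mul_self]
  rcases Nat.even_or_odd' k with ⟨m, rfl | rfl⟩
  · rw [(polyIntegral_monicPoly_mul_X_pow m m).1, descFactorial_smul_polyIntegral, sqNorm_even]
    simp
  · rw [(polyIntegral_monicPoly_mul_X_pow m m).2, mul_comm _ (-(2 * m + 3) : ℝ), ← smul_smul,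
      descFactorial_smul_polyIntegral, sqNorm_odd, smul_smul, ← Quaternion.coe_smul, pow_succ,
      pow_mul]
    simp

lemma exists_sum_monicPoly (n : ℕ) : ∀ q : ℝ[X], q.degree < n →
    ∃ c : ℕ → ℝ, q = ∑ k ∈ Finset.range n, c k • monicPoly k := by
  induction n with
  | zero =>
    intro q hq
    refine ⟨0, ?_⟩
    simpa [Polynomial.degree_eq_bot, Nat.WithBot.lt_zero_iff] using hq
  | succ n ih =>
    intro q hq
    have h : (q - q.coeff n • monicPoly n).degree < n := by
      rw [Polynomial.degree_lt_iff_coeff_zero] at hq ⊢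
      intro m hm
      rcases hm.eq_or_lt with rfl | hm
      · have := (monicPoly_monic_natDegree n).1.coeff_natDegree
        rw [(monicPoly_monic_natDegree n).2] at this
        simp [this]
      · rw [Polynomial.coeff_sub, Polynomial.coeff_smul, hq m hm,
          Polynomial.coeff_eq_zero_of_natDegree_lt ((monicPoly_monic_natDegree n).2.trans_lt hm)]
        simp
    obtain ⟨c, hc⟩ := ih _ h
    refine ⟨fun k => if k = n then q.coeff n else c k, ?_⟩
    rw [Finset.sum_range_succ]
    simp only [if_true]
    rw [← sub_eq_iff_eq_add, hc]
    refine Finset.sum_congr rfl fun k hk => ?_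
    simp only [if_neg (Finset.mem_range.1 hk).ne]

/-- Gram–Schmidt subtracts from `z ^ n` its projections on the earlier polynomials. By orthogonality
these are the terms of the expansion of `X ^ n - monicPoly n`, with real, hence central,
coefficients. -/
theorem orthoPoly_eq_aeval (n : ℕ) :
    orthoPoly n = fun z => Polynomial.aeval (toPure z) (monicPoly n) := by
  induction n using Nat.strong_induction_on with
  | _ n ih =>
    obtain ⟨c, hc⟩ := exists_sum_monicPoly n _ (degree_X_pow_sub_monicPoly n)
    have hX : (fun w => toPure w ^ n) =
        fun w => Polynomial.aeval (toPure w) (Polynomial.X ^ n : ℝ[X]) := by simp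
    have hcoef : ∀ k < n, (scalarProd (orthoPoly k) (orthoPoly k))⁻¹ *
          scalarProd (orthoPoly k) (fun w => toPure w ^ n) = (c k : ℍ[ℝ]) := by
      intro k hk
      have hk' : polyIntegral (monicPoly k * Polynomial.X ^ n) =
          c k • polyIntegral (monicPoly k * monicPoly k) := by
        rw [sub_eq_iff_eq_add.1 hc, mul_add, map_add, polyIntegral_monicPoly_mul_monicPoly hk.ne,
          add_zero, Finset.mul_sum, map_sum, Finset.sum_eq_single_of_mem k (Finset.mem_range.2 hk)]
        · rw [mul_smul_comm, map_smul]
        · intro j _ hj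
          rw [mul_smul_comm, map_smul, polyIntegral_monicPoly_mul_monicPoly hj.symm, smul_zero]
      rw [ih k hk, hX, scalarProd_monicPoly_left k (Polynomial.X ^ n), hk', smul_comm,
        ← scalarProd_monicPoly_left, scalarProd_monicPoly_self, ← Quaternion.coe_smul,
        ← Quaternion.coe_inv, ← Quaternion.coe_mul, smul_eq_mul]
      congr 1
      field_simp [(sqNorm_pos k).ne']
    funext z
    rw [orthoPoly]
    have hs : ∑ k : Fin n, orthoPoly k z * ((scalarProd (orthoPoly k) (orthoPoly k))⁻¹ *
          scalarProd (orthoPoly k) (fun w => toPure w ^ n)) =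
        Polynomial.aeval (toPure z) (Polynomial.X ^ n - monicPoly n) := by
      rw [hc, map_sum, ← Fin.sum_univ_eq_sum_range
        (fun k => Polynomial.aeval (toPure z) (c k • monicPoly k))]
      refine Finset.sum_congr rfl fun k _ => ?_
      rw [hcoef k k.2, ih k k.2, map_smul, Quaternion.mul_coe_eq_smul]
    refine (congrArg (fun w => toPure z ^ n - w) hs).trans ?_
    rw [map_sub, map_pow, Polynomial.aeval_X, sub_sub_cancel]

lemma normConst_eq_sqNorm (k : ℕ) : normConst k = sqNorm k := by
  rw [normConst, orthoPoly_eq_aeval, scalarProd_monicPoly_self, Quaternion.re_coe]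

lemma continuous_orthoPoly (k : ℕ) : Continuous (orthoPoly k) := by
  rw [orthoPoly_eq_aeval]
  exact continuous_aeval_toPure _

/-! ### The one-point density -/

lemma kernelDet_one (K : E3 → E3 → ℍ[ℝ]) (x : Fin 1 → E3) :
    kernelDet K 1 x = (K (x 0) (x 0)).re := by
  simp [kernelDet, mooreDet, cycleProd, Function.minimalPeriod_id]

lemma kernel_self_re (N : ℕ) (x : E3) :
    (kernel N x x).re = ∑ k ∈ Finset.range N, ‖orthoPoly k x‖ ^ 2 / sqNorm k := by
  have h : kernel N x x =
      ((∑ k ∈ Finset.range N, ‖orthoPoly k x‖ ^ 2 / sqNorm k : ℝ) : ℍ[ℝ]) := by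
    have hsum := map_sum (algebraMap ℝ ℍ[ℝ]) (fun k => ‖orthoPoly k x‖ ^ 2 / sqNorm k)
      (Finset.range N)
    rw [Quaternion.algebraMap_def] at hsum
    rw [hsum, kernel]
    refine Finset.sum_congr rfl fun k _ => ?_
    rw [Quaternion.self_mul_star, Quaternion.normSq_eq_norm_mul_self, normConst_eq_sqNorm,
      ← Quaternion.coe_smul, smul_eq_mul]
    congr 1
    ring
  rw [h, Quaternion.re_coe]

lemma fieldDensity_eq (N : ℕ) (x : E3) : fieldDensity N x =
    (∑ k ∈ Finset.range N, ‖orthoPoly k x‖ ^ 2 / sqNorm k) * gaussDensity x := by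
  rw [fieldDensity, kernelDet_one, kernel_self_re]

lemma fieldDensity_nonneg (N : ℕ) (x : E3) : 0 ≤ fieldDensity N x := by
  rw [fieldDensity_eq]
  exact mul_nonneg (Finset.sum_nonneg fun k _ => div_nonneg (sq_nonneg _) (sqNorm_pos k).le)
    (gaussDensity_pos x).le

lemma continuous_fieldDensity (N : ℕ) : Continuous (fieldDensity N) := by
  rw [funext (fieldDensity_eq N)]
  exact (continuous_finsetSum _ fun k _ =>
    ((continuous_orthoPoly k).norm.pow 2).div_const _).mul continuous_gaussDensity

lemma isOnePointDensity_of_isDeterminantalField {Ω : Type*} [MeasurableSpace Ω] {P : Measure Ω}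
    {X : Ω → Measure E3} {N : ℕ} (h : IsDeterminantalField P X gaussMeasure (kernel N)) :
    IsOnePointDensity P X (fieldDensity N) := by
  refine ⟨fieldDensity_nonneg N, fun A hA => ?_⟩
  have h1 := (h.correlation 1).factorial_moment 1 (fun _ => A) (fun _ => 1) (by simp)
    (fun _ => hA) (fun i j hij => absurd (Subsingleton.elim i j) hij)
  simp only [Finset.univ_unique, Finset.prod_const, Finset.card_singleton, pow_one,
    Finset.range_one, Finset.prod_singleton, Nat.cast_zero, tsub_zero] at h1
  rw [h1]
  -- Both index types have a single element, so the product condition is membership of one point.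
  have hset : {x : Fin 1 → E3 | ∀ (i : Fin 1) (j : Fin 1),
      x (Fin.cast (by simp) (finSigmaFinEquiv (n := fun _ : Fin 1 => 1) ⟨i, j⟩)) ∈ A} =
      (MeasurableEquiv.funUnique (Fin 1) E3) ⁻¹' A := by
    ext x
    simp only [Set.mem_ofPred_eq, Set.mem_preimage, MeasurableEquiv.funUnique_apply]
    constructor
    · intro hx
      convert hx 0 0
    · intro hx i j
      convert hx
  have hmp := measurePreserving_funUnique gaussMeasure (Fin 1)
  refine (congrArg (fun s => ∫⁻ x in s, ENNReal.ofReal (kernelDet (kernel N) 1 x)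
    ∂(Measure.pi fun _ => gaussMeasure)) hset).trans ?_
  simp only [kernelDet_one]
  refine (hmp.setLIntegral_comp_preimage_emb (MeasurableEquiv.measurableEmbedding _)
    (fun y => ENNReal.ofReal (kernel N y y).re) A).trans ?_
  rw [gaussMeasure,
    setLIntegral_withDensity_eq_setLIntegral_mul _ measurable_ofReal_gaussDensity _ hA]
  · refine lintegral_congr fun x => ?_
    rw [Pi.mul_apply, ← ENNReal.ofReal_mul (gaussDensity_pos x).le, mul_comm, fieldDensity,
      kernelDet_one]
  · simp only [kernel_self_re]
    exact (continuous_finsetSum _ fun k _ =>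
      ((continuous_orthoPoly k).norm.pow 2).div_const _).measurable.ennreal_ofReal

lemma IsOnePointDensity.unique {Ω : Type*} [MeasurableSpace Ω] {P : Measure Ω}
    {X : Ω → Measure E3} {ρ ρ' : E3 → ℝ} (hρ : Continuous ρ) (hρ' : Continuous ρ')
    (h : IsOnePointDensity P X ρ) (h' : IsOnePointDensity P X ρ') : ρ = ρ' := by
  have hae : (fun x => ENNReal.ofReal (ρ x)) =ᵐ[volume] fun x => ENNReal.ofReal (ρ' x) :=
    ae_eq_of_forall_setLIntegral_eq_of_sigmaFinite hρ.measurable.ennreal_ofReal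
      hρ'.measurable.ennreal_ofReal fun A hA _ => by rw [← h.intensity A hA, h'.intensity A hA]
  refine (Continuous.ae_eq_iff_eq volume hρ hρ').1 ?_
  filter_upwards [hae] with x hx
  exact (ENNReal.ofReal_eq_ofReal_iff (h.nonneg x) (h'.nonneg x)).1 hx

/-! ### The density in terms of Hermite polynomials -/

/-- The probabilists' Hermite polynomials as functions. -/
def herm : ℕ → ℝ → ℝ
  | 0 => fun _ => 1
  | 1 => fun x => x
  | n + 2 => fun x => x * herm (n + 1) x - (n + 1) * herm n x

/-- The derivative of the Hermite polynomial. -/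
def hermDeriv : ℕ → ℝ → ℝ
  | 0 => fun _ => 0
  | n + 1 => fun x => (n + 1) * herm n x

lemma herm_succ (n : ℕ) (x : ℝ) : herm (n + 1) x = x * herm n x - hermDeriv n x := by
  cases n with
  | zero => simp [herm, hermDeriv]
  | succ n => simp [herm, hermDeriv]

lemma hermDeriv_succ (n : ℕ) (x : ℝ) : hermDeriv (n + 1) x = (n + 1) * herm n x := rfl

lemma hasDerivAt_herm (n : ℕ) (x : ℝ) : HasDerivAt (herm n) (hermDeriv n x) x := by
  induction n using Nat.twoStepInduction with
  | zero => exact hasDerivAt_const x 1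
  | one => simpa [hermDeriv, herm] using hasDerivAt_id' x
  | more n h0 h1 =>
    have h := ((hasDerivAt_id x).mul h1).sub (h0.const_mul (n + 1 : ℝ))
    refine h.congr_deriv ?_
    simp only [hermDeriv_succ, herm_succ n, id]
    push_cast
    ring

/-- Confluent Christoffel–Darboux, written with `He_M` and its derivative so that it makes sense at
`M = 0` and turns into an energy after multiplication by the Gaussian. -/
lemma sum_herm_sq (M : ℕ) (x : ℝ) :
    ∑ k ∈ Finset.range M, herm k x ^ 2 / k.factorial =
      (hermDeriv M x ^ 2 - x * hermDeriv M x * herm M x + M * herm M x ^ 2) / M.factorial := by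
  induction M with
  | zero => simp [hermDeriv]
  | succ M ih =>
    rw [Finset.sum_range_succ, ih, hermDeriv_succ, herm_succ, Nat.factorial_succ]
    have := M.factorial_pos
    push_cast
    field_simp
    ring

lemma orthoPoly_add_two (k : ℕ) (x : E3) : orthoPoly (k + 2) x =
    toPure x * orthoPoly (k + 1) x + recCoeff (k + 1) • orthoPoly k x := by
  simp only [orthoPoly_eq_aeval, monicPoly, map_add, map_mul, Polynomial.aeval_X,
    Polynomial.aeval_C, Algebra.smul_def]

/-- The odd formula comes from `z P_{2m+1} = P_{2m+2} - (2m+3) P_{2m}` and `He_{2m+3} = r He_{2m+2}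
- (2m+2) He_{2m+1}`. -/
lemma orthoPoly_eq_herm {x : E3} (hx : x ≠ 0) (m : ℕ) :
    orthoPoly (2 * m) x = ((-1) ^ m * herm (2 * m + 1) ‖x‖ / ‖x‖ : ℝ) • (1 : ℍ[ℝ]) ∧
    orthoPoly (2 * m + 1) x = ((-1) ^ m * (‖x‖ * herm (2 * m + 2) ‖x‖ + herm (2 * m + 1) ‖x‖)
      / ‖x‖ ^ 3 : ℝ) • toPure x := by
  have hr : ‖x‖ ≠ 0 := norm_ne_zero_iff.2 hx
  have hsq : toPure x * toPure x = (-‖x‖ ^ 2) • (1 : ℍ[ℝ]) := by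
    rw [toPure_mul_self, ← Quaternion.coe_one, ← Quaternion.coe_smul, smul_eq_mul, mul_one]
  induction m with
  | zero =>
    constructor
    · simp [orthoPoly_eq_aeval, monicPoly, herm, hr]
    · have : (‖x‖ * (‖x‖ * ‖x‖ - 1) + ‖x‖) / ‖x‖ ^ 3 = 1 := by
        field_simp
        ring
      simp [orthoPoly_eq_aeval, monicPoly, herm, this]
  | succ m ih =>
    obtain ⟨h0, h1⟩ := ih
    have e : orthoPoly (2 * (m + 1)) x =
        ((-1) ^ (m + 1) * herm (2 * (m + 1) + 1) ‖x‖ / ‖x‖ : ℝ) • (1 : ℍ[ℝ]) := by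
      rw [mul_add, mul_one, orthoPoly_add_two, h0, h1, mul_smul_comm, hsq, smul_smul, smul_smul,
        ← add_smul, recCoeff, if_neg (by simp), herm_succ (2 * m + 2), hermDeriv_succ]
      congr 1
      push_cast
      field_simp
      ring
    refine ⟨e, ?_⟩
    rw [show 2 * (m + 1) + 1 = (2 * m + 1) + 2 by ring, orthoPoly_add_two,
      show 2 * m + 1 + 1 = 2 * (m + 1) by ring, e, h1, mul_smul_comm, mul_one, smul_smul,
      ← add_smul, recCoeff, if_pos (by simp), show 2 * (m + 1) + 2 = 2 * m + 3 + 1 by ring,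
      show 2 * (m + 1) + 1 = 2 * m + 2 + 1 by ring, show 2 * m + 1 + 2 = 2 * m + 2 + 1 by ring,
      herm_succ (2 * m + 3), hermDeriv_succ,
      herm_succ (2 * m + 2), hermDeriv_succ]
    congr 1
    push_cast
    field_simp
    ring

lemma norm_sq_orthoPoly {x : E3} (hx : x ≠ 0) (m : ℕ) :
    ‖orthoPoly (2 * m) x‖ ^ 2 = herm (2 * m + 1) ‖x‖ ^ 2 / ‖x‖ ^ 2 ∧
    ‖orthoPoly (2 * m + 1) x‖ ^ 2 =
      (‖x‖ * herm (2 * m + 2) ‖x‖ + herm (2 * m + 1) ‖x‖) ^ 2 / ‖x‖ ^ 4 := by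
  have hr : ‖x‖ ≠ 0 := norm_ne_zero_iff.2 hx
  obtain ⟨h0, h1⟩ := orthoPoly_eq_herm hx m
  rw [h0, h1, norm_smul, norm_smul, norm_toPure, norm_one, mul_pow, mul_pow, Real.norm_eq_abs,
    Real.norm_eq_abs, sq_abs, sq_abs]
  have h2 : ((-1 : ℝ) ^ m) ^ 2 = 1 := by
    rw [← pow_mul, mul_comm, pow_mul]
    simp
  constructor
  · rw [div_pow, mul_pow, h2]
    ring
  · rw [div_pow, mul_pow, h2]
    field_simp

/-- The term of index `2m` is exactly the Hermite term of index `2m+1` over `r ^ 2`. The term of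
index `2m+1` is the Hermite term of index `2m+2` over `r ^ 2` plus a difference of consecutive
values of the correction, which telescopes. -/
lemma sum_norm_sq_orthoPoly_even {x : E3} (hx : x ≠ 0) (m : ℕ) :
    ∑ k ∈ Finset.range (2 * m), ‖orthoPoly k x‖ ^ 2 / sqNorm k =
      (∑ k ∈ Finset.range (2 * m + 1), herm k ‖x‖ ^ 2 / k.factorial -
        herm (2 * m + 1) ‖x‖ ^ 2 / (‖x‖ ^ 2 * (2 * m + 1).factorial)) / ‖x‖ ^ 2 := by
  have hr : ‖x‖ ≠ 0 := norm_ne_zero_iff.2 hx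
  induction m with
  | zero => simp [herm, hr]
  | succ m ih =>
    rw [show 2 * (m + 1) = 2 * m + 1 + 1 by ring, Finset.sum_range_succ, Finset.sum_range_succ, ih,
      (norm_sq_orthoPoly hx m).1, (norm_sq_orthoPoly hx m).2, sqNorm_even, sqNorm_odd,
      Finset.sum_range_succ _ (2 * m + 1 + 1), Finset.sum_range_succ _ (2 * m + 1),
      show 2 * m + 1 + 1 + 1 = 2 * m + 2 + 1 by ring,
      herm_succ (2 * m + 2), hermDeriv_succ, Nat.factorial_succ (2 * m + 2),
      Nat.factorial_succ (2 * m + 1)]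
    have := (2 * m + 1).factorial_pos
    push_cast
    field_simp
    ring

lemma sum_norm_sq_orthoPoly_odd {x : E3} (hx : x ≠ 0) (m : ℕ) :
    ∑ k ∈ Finset.range (2 * m + 1), ‖orthoPoly k x‖ ^ 2 / sqNorm k =
      (∑ k ∈ Finset.range (2 * m + 2), herm k ‖x‖ ^ 2 / k.factorial -
        herm (2 * m + 1) ‖x‖ ^ 2 / (‖x‖ ^ 2 * (2 * m + 1).factorial)) / ‖x‖ ^ 2 := by
  have hr : ‖x‖ ≠ 0 := norm_ne_zero_iff.2 hx
  rw [Finset.sum_range_succ, sum_norm_sq_orthoPoly_even hx, (norm_sq_orthoPoly hx m).1, sqNorm_even,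
    Finset.sum_range_succ _ (2 * m + 1)]
  field_simp
  ring

/-! ### Adiabatic invariance for the harmonic oscillator equation -/

/-- The energy of a solution `φ` of `φ'' = -(a - x² / 4) φ` with derivative `ψ`. -/
def energy (a : ℝ) (φ ψ : ℝ → ℝ) (x : ℝ) : ℝ := ψ x ^ 2 + (a - x ^ 2 / 4) * φ x ^ 2

section Oscillator

variable {a : ℝ} {φ ψ : ℝ → ℝ}

lemma hasDerivAt_energy (hφ : ∀ x, HasDerivAt φ (ψ x) x)
    (hψ : ∀ x, HasDerivAt ψ (-(a - x ^ 2 / 4) * φ x) x) (x : ℝ) :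
    HasDerivAt (energy a φ ψ) (-(x / 2) * φ x ^ 2) x := by
  have hQ : HasDerivAt (fun x : ℝ => a - x ^ 2 / 4) (-(x / 2)) x := by
    refine (((hasDerivAt_id' x).pow 2).div_const 4 |>.const_sub a).congr_deriv ?_
    norm_num
    ring
  refine (((hψ x).pow 2).add (hQ.mul ((hφ x).pow 2))).congr_deriv ?_
  norm_num
  ring

lemma energy_antitoneOn (hφ : ∀ x, HasDerivAt φ (ψ x) x)
    (hψ : ∀ x, HasDerivAt ψ (-(a - x ^ 2 / 4) * φ x) x) :
    AntitoneOn (energy a φ ψ) (Set.Ici 0) := by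
  refine antitoneOn_of_deriv_nonpos (convex_Ici 0)
    (fun x _ => (hasDerivAt_energy hφ hψ x).continuousAt.continuousWithinAt)
    (fun x _ => (hasDerivAt_energy hφ hψ x).differentiableAt.differentiableWithinAt) fun x hx => ?_
  rw [interior_Ici, Set.mem_Ioi] at hx
  rw [(hasDerivAt_energy hφ hψ x).deriv]
  have := mul_nonneg (half_pos hx).le (sq_nonneg (φ x))
  linarith

/-- With `w = √(a - x ^ 2 / 4)` and `η = x / (4 w ^ 3)`, the derivative of `E / w` is `η (ψ ^ 2 - w
^ 2 φ ^ 2) = η (φ ψ)'`, an oscillating term that one integration by parts makes small. -/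
lemma energy_adiabatic (hφ : ∀ x, HasDerivAt φ (ψ x) x)
    (hψ : ∀ x, HasDerivAt ψ (-(a - x ^ 2 / 4) * φ x) x) {X h : ℝ} (hX : 0 ≤ X)
    (hq : 0 < a - X ^ 2 / 4) (hh : h = X / (4 * √(a - X ^ 2 / 4) ^ 3)) (h1 : h ≤ 1) :
    energy a φ ψ 0 / √a * Real.exp (-h) ≤ energy a φ ψ X / √(a - X ^ 2 / 4) * (1 + h / 2) ∧
    energy a φ ψ X / √(a - X ^ 2 / 4) * (1 - h / 2) ≤ energy a φ ψ 0 / √a * Real.exp h := by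
  set w : ℝ → ℝ := fun x => √(a - x ^ 2 / 4) with hw
  set η : ℝ → ℝ := fun x => x / (4 * w x ^ 3) with hη
  have hQ : ∀ x ∈ Set.Icc 0 X, 0 < a - x ^ 2 / 4 := fun x hx => by
    have := pow_le_pow_left₀ hx.1 hx.2 2
    linarith
  have hw0 : ∀ x ∈ Set.Icc 0 X, 0 < w x := fun x hx => Real.sqrt_pos.2 (hQ x hx)
  have hw2 : ∀ x ∈ Set.Icc 0 X, w x ^ 2 = a - x ^ 2 / 4 := fun x hx => Real.sq_sqrt (hQ x hx).le
  have hη0 : ∀ x ∈ Set.Icc 0 X, 0 ≤ η x := fun x hx =>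
    div_nonneg hx.1 (mul_nonneg (by norm_num) (pow_nonneg (hw0 x hx).le 3))
  have hηX : η X = h := hh.symm
  have hXm : X ∈ Set.Icc 0 X := ⟨hX, le_rfl⟩
  have h0m : (0 : ℝ) ∈ Set.Icc 0 X := ⟨le_rfl, hX⟩
  have hη1 : ∀ x ∈ Set.Icc 0 X, η x ≤ 1 := fun x hx => by
    refine le_trans ?_ (hηX.trans_le h1)
    have hww : w X ≤ w x := Real.sqrt_le_sqrt (by
      have := pow_le_pow_left₀ hx.1 hx.2 2
      linarith)
    have := hw0 X hXm
    simp only [hη]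
    gcongr
    exact hx.2
  have dw : ∀ x ∈ Set.Icc 0 X, HasDerivAt w (-x / (4 * w x)) x := fun x hx => by
    have hQ' : HasDerivAt (fun x : ℝ => a - x ^ 2 / 4) (-(x / 2)) x := by
      refine (((hasDerivAt_id' x).pow 2).div_const 4 |>.const_sub a).congr_deriv ?_
      norm_num
      ring
    refine (hQ'.sqrt (hQ x hx).ne').congr_deriv ?_
    change -(x / 2) / (2 * w x) = _
    have := hw0 x hx
    field_simp
    norm_num
  set η' : ℝ → ℝ := fun x => 1 / (4 * w x ^ 3) + 3 * x ^ 2 / (16 * w x ^ 5) with hη'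
  have dη : ∀ x ∈ Set.Icc 0 X, HasDerivAt η (η' x) x := fun x hx => by
    have hwx := hw0 x hx
    refine ((hasDerivAt_id' x).div (((dw x hx).pow 3).const_mul 4)
      (mul_pos four_pos (pow_pos hwx 3)).ne').congr_deriv ?_
    simp only [hη']
    norm_num
    field_simp
    ring
  have hη'0 : ∀ x ∈ Set.Icc 0 X, 0 ≤ η' x := fun x hx => by
    have hwx := hw0 x hx
    simp only [hη']
    positivity
  -- Subtracting `η φ ψ` leaves only `-η' φ ψ` in the derivative.
  set G : ℝ → ℝ := fun x => energy a φ ψ x / w x - η x * (φ x * ψ x) with hG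
  have dG : ∀ x ∈ Set.Icc 0 X, HasDerivAt G (-η' x * (φ x * ψ x)) x := fun x hx => by
    have hwx := hw0 x hx
    refine (((hasDerivAt_energy hφ hψ x).div (dw x hx) hwx.ne').sub
      ((dη x hx).mul ((hφ x).mul (hψ x)))).congr_deriv ?_
    simp only [energy, hη, ← hw2 x hx, Pi.mul_apply]
    field_simp
    ring
  have hb : ∀ x ∈ Set.Icc 0 X, |φ x * ψ x| ≤ energy a φ ψ x / w x / 2 := fun x hx => by
    have hwx := hw0 x hx
    rw [div_div, le_div_iff₀ (by positivity), energy, ← hw2 x hx]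
    have := two_mul_le_add_sq |ψ x| (w x * |φ x|)
    rw [sq_abs, mul_pow, sq_abs] at this
    rw [abs_mul]
    linarith
  have hE : ∀ x ∈ Set.Icc 0 X, 0 ≤ energy a φ ψ x / w x := fun x hx => by
    have := (abs_nonneg _).trans (hb x hx)
    linarith
  have hprod : ∀ x ∈ Set.Icc 0 X, |η x * (φ x * ψ x)| ≤ energy a φ ψ x / w x * (η x / 2) :=
    fun x hx => by
      rw [abs_mul, abs_of_nonneg (hη0 x hx)]
      have := mul_le_mul_of_nonneg_left (hb x hx) (hη0 x hx)
      linarith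
  -- Since `η ≤ 1`, the correction is at most `E / (2w)`, so `G ≥ E / (2w) ≥ |φ ψ|` and therefore
  -- `|G'| ≤ η' G`. The next two steps are the resulting Grönwall bounds.
  have hlow : ∀ x ∈ Set.Icc 0 X, |φ x * ψ x| ≤ G x := fun x hx => by
    have h2 := (abs_le.1 (hprod x hx)).2
    have h3 := mul_le_mul_of_nonneg_left (hη1 x hx) (hE x hx)
    have h4 := hb x hx
    simp only [hG]
    linarith
  have hmono : MonotoneOn (fun x => G x * Real.exp (η x)) (Set.Icc 0 X) := by
    have d : ∀ x ∈ Set.Icc 0 X, HasDerivAt (fun x => G x * Real.exp (η x))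
        (-η' x * (φ x * ψ x) * Real.exp (η x) + G x * (Real.exp (η x) * η' x)) x :=
      fun x hx => (dG x hx).mul (dη x hx).exp
    refine monotoneOn_of_deriv_nonneg (convex_Icc 0 X)
      (fun x hx => (d x hx).continuousAt.continuousWithinAt)
      (fun x hx => (d x (interior_subset hx)).differentiableAt.differentiableWithinAt)
      fun x hx => ?_
    have hx := interior_subset hx
    rw [(d x hx).deriv]
    have := mul_nonneg (mul_nonneg (hη'0 x hx) (Real.exp_pos (η x)).le)
      (sub_nonneg.2 ((le_abs_self _).trans (hlow x hx)))
    linarith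
  have hanti : AntitoneOn (fun x => G x * Real.exp (-η x)) (Set.Icc 0 X) := by
    have d : ∀ x ∈ Set.Icc 0 X, HasDerivAt (fun x => G x * Real.exp (-η x))
        (-η' x * (φ x * ψ x) * Real.exp (-η x) + G x * (Real.exp (-η x) * -η' x)) x :=
      fun x hx => (dG x hx).mul (dη x hx).neg.exp
    refine antitoneOn_of_deriv_nonpos (convex_Icc 0 X)
      (fun x hx => (d x hx).continuousAt.continuousWithinAt)
      (fun x hx => (d x (interior_subset hx)).differentiableAt.differentiableWithinAt)
      fun x hx => ?_
    have hx := interior_subset hx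
    rw [(d x hx).deriv]
    have := mul_nonneg (mul_nonneg (hη'0 x hx) (Real.exp_pos (-η x)).le)
      (neg_le_iff_add_nonneg.1 ((neg_le_abs _).trans (hlow x hx)))
    linarith
  have m1 := hmono h0m hXm hX
  have m2 := hanti h0m hXm hX
  have hG0 : G 0 = energy a φ ψ 0 / √a := by simp [hG, hη, hw]
  have hη00 : η 0 = 0 := by simp [hη]
  simp only [hG0, hη00, hηX, neg_zero, Real.exp_zero, mul_one] at m1 m2
  have b := abs_le.1 (hprod X hXm)
  rw [hηX] at b
  have hGX : G X = energy a φ ψ X / w X - h * (φ X * ψ X) := by simp only [hG, hηX]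
  constructor
  · rw [Real.exp_neg, ← div_eq_mul_inv, div_le_iff₀ (Real.exp_pos h)]
    refine m1.trans (mul_le_mul_of_nonneg_right ?_ (Real.exp_pos h).le)
    rw [hGX]
    have := b.1
    change _ ≤ energy a φ ψ X / w X * (1 + h / 2)
    linarith
  · rw [Real.exp_neg, ← div_eq_mul_inv, div_le_iff₀ (Real.exp_pos h)] at m2
    refine le_trans ?_ m2
    rw [hGX]
    have := b.2
    change energy a φ ψ X / w X * (1 - h / 2) ≤ _
    linarith

end Oscillator

/-! ### Hermite functions -/

/-- The normalized Hermite functions. -/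
def hermFun (M : ℕ) (x : ℝ) : ℝ :=
  herm M x * Real.exp (-x ^ 2 / 4) / √(√(2 * Real.pi) * M.factorial)

/-- The derivative of the normalized Hermite functions. -/
def hermFunDeriv (M : ℕ) (x : ℝ) : ℝ :=
  (hermDeriv M x - x / 2 * herm M x) * Real.exp (-x ^ 2 / 4) / √(√(2 * Real.pi) * M.factorial)

lemma hasDerivAt_exp_neg_sq_div_four (x : ℝ) : HasDerivAt (fun x : ℝ => Real.exp (-x ^ 2 / 4))
    (Real.exp (-x ^ 2 / 4) * (-x / 2)) x := by
  refine ((((hasDerivAt_id' x).pow 2).neg.div_const 4).exp).congr_deriv ?_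
  norm_num
  ring

lemma hasDerivAt_hermFun (M : ℕ) (x : ℝ) : HasDerivAt (hermFun M) (hermFunDeriv M x) x := by
  refine (((hasDerivAt_herm M x).mul (hasDerivAt_exp_neg_sq_div_four x)).div_const _).congr_deriv ?_
  rw [hermFunDeriv]
  ring

lemma hasDerivAt_hermDeriv (M : ℕ) (x : ℝ) :
    HasDerivAt (hermDeriv M) (x * hermDeriv M x - M * herm M x) x := by
  cases M with
  | zero => simpa [hermDeriv] using hasDerivAt_const x (0 : ℝ)
  | succ M =>
    refine ((hasDerivAt_herm M x).const_mul (M + 1 : ℝ)).congr_deriv ?_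
    rw [hermDeriv_succ, herm_succ]
    push_cast
    ring

lemma hasDerivAt_hermFunDeriv (M : ℕ) (x : ℝ) :
    HasDerivAt (hermFunDeriv M) (-((M + 1 / 2 : ℝ) - x ^ 2 / 4) * hermFun M x) x := by
  refine ((((hasDerivAt_hermDeriv M x).sub (((hasDerivAt_id' x).div_const 2).mul
    (hasDerivAt_herm M x))).mul (hasDerivAt_exp_neg_sq_div_four x)).div_const _).congr_deriv ?_
  rw [hermFun]
  simp only [Pi.sub_apply, Pi.mul_apply]
  ring

/-- The energy of the `M`-th Hermite function. -/
def hermEnergy (M : ℕ) : ℝ → ℝ := energy (M + 1 / 2) (hermFun M) (hermFunDeriv M)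

lemma hermFun_sq (M : ℕ) (x : ℝ) : hermFun M x ^ 2 =
    Real.exp (-x ^ 2 / 2) / √(2 * Real.pi) * (herm M x ^ 2 / M.factorial) := by
  rw [hermFun, div_pow, mul_pow, Real.sq_sqrt (by positivity), ← Real.exp_nat_mul]
  rw [show ((2 : ℕ) : ℝ) * (-x ^ 2 / 4) = -x ^ 2 / 2 by push_cast; ring]
  have := M.factorial_pos
  field_simp

lemma hermFunDeriv_sq (M : ℕ) (x : ℝ) : hermFunDeriv M x ^ 2 =
    Real.exp (-x ^ 2 / 2) / √(2 * Real.pi) *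
      ((hermDeriv M x - x / 2 * herm M x) ^ 2 / M.factorial) := by
  rw [hermFunDeriv, div_pow, mul_pow, Real.sq_sqrt (by positivity), ← Real.exp_nat_mul]
  rw [show ((2 : ℕ) : ℝ) * (-x ^ 2 / 4) = -x ^ 2 / 2 by push_cast; ring]
  have := M.factorial_pos
  field_simp

lemma sum_hermFun_sq (M : ℕ) (x : ℝ) :
    ∑ k ∈ Finset.range M, hermFun k x ^ 2 = hermEnergy M x - hermFun M x ^ 2 / 2 := by
  simp only [hermFun_sq]
  rw [← Finset.mul_sum, sum_herm_sq, hermEnergy, energy, hermFun_sq, hermFunDeriv_sq]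
  ring

lemma hermEnergy_nonneg (M : ℕ) (x : ℝ) : 0 ≤ hermEnergy M x := by
  have h := sum_hermFun_sq M x
  have h1 : 0 ≤ ∑ k ∈ Finset.range M, hermFun k x ^ 2 := Finset.sum_nonneg fun k _ => sq_nonneg _
  have h2 := sq_nonneg (hermFun M x)
  linarith

/-! ### The energy at the origin -/

lemma herm_zero_right (m : ℕ) :
    herm (2 * m) 0 = (-1) ^ m * (2 * m).factorial / (2 ^ m * m.factorial) ∧
    herm (2 * m + 1) 0 = 0 := by
  induction m with
  | zero => simp [herm]
  | succ m ih =>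
    have h1 : herm (2 * (m + 1)) 0 = (-1) ^ (m + 1) * (2 * (m + 1)).factorial /
        (2 ^ (m + 1) * (m + 1).factorial) := by
      rw [mul_add, mul_one, herm_succ, hermDeriv_succ, ih.1, Nat.factorial_succ (2 * m + 1),
        Nat.factorial_succ (2 * m), Nat.factorial_succ m]
      have := m.factorial_pos
      push_cast
      field_simp
      ring
    refine ⟨h1, ?_⟩
    rw [show 2 * (m + 1) + 1 = 2 * m + 2 + 1 by ring, herm_succ, hermDeriv_succ, ih.2]
    simp

lemma herm_zero_sq (m : ℕ) : (herm (2 * m) 0 ^ 2 / (2 * m).factorial) ^ 2 =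
    1 / ((2 * m + 1) * Real.Wallis.W m) := by
  have hW := Real.Wallis.W_eq_factorial_ratio m
  have h1 := m.factorial_pos
  have h2 := (2 * m).factorial_pos
  have h3 : ((-1 : ℝ) ^ m) ^ 2 = 1 := by
    rw [← pow_mul, mul_comm, pow_mul]
    simp
  rw [hW, (herm_zero_right m).1, div_pow, div_pow, mul_pow, h3]
  have h4 : (2 : ℝ) ^ (4 * m) = (2 ^ m) ^ 4 := by ring
  rw [h4]
  field_simp

/-- At the origin only `φ` contributes for even `M` and only `φ'` for odd `M`. Squaring turns the
central binomial ratio into Wallis' partial product. -/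
lemma hermEnergy_zero_bounds (M : ℕ) :
    (M / (M + 1)) * (1 / (2 * Real.pi * Real.Wallis.W (M / 2))) ≤
      (hermEnergy M 0 / √(M + 1 / 2)) ^ 2 ∧
    (hermEnergy M 0 / √(M + 1 / 2)) ^ 2 ≤ 1 / (2 * Real.pi * Real.Wallis.W (M / 2)) := by
  have hpi := Real.pi_pos
  rcases Nat.even_or_odd' M with ⟨m, rfl | rfl⟩
  · have hW := Real.Wallis.W_pos m
    have hE : (hermEnergy (2 * m) 0 / √((2 * m : ℕ) + 1 / 2)) ^ 2 =
        ((2 * m + 1 / 2) / (2 * m + 1)) * (1 / (2 * Real.pi * Real.Wallis.W m)) := by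
      have h0 : hermDeriv (2 * m) 0 = 0 := by
        cases m with
        | zero => rfl
        | succ m => rw [show 2 * (m + 1) = 2 * m + 1 + 1 by ring, hermDeriv_succ,
            (herm_zero_right m).2, mul_zero]
      have h := herm_zero_sq m
      rw [hermEnergy, energy, hermFun_sq, hermFunDeriv_sq, h0, div_pow,
        Real.sq_sqrt (by positivity)]
      have h2 : √(2 * Real.pi) ^ 2 = 2 * Real.pi := Real.sq_sqrt (by positivity)
      generalize √(2 * Real.pi) = T at h2 ⊢
      norm_num
      rw [mul_pow, mul_pow, inv_pow, h2, h]
      field_simp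
    rw [hE, Nat.mul_div_cancel_left m two_pos]
    push_cast
    constructor
    · gcongr
      norm_num
    · refine mul_le_of_le_one_left (by positivity) ?_
      rw [div_le_one (by positivity)]
      norm_num
  · have hW := Real.Wallis.W_pos m
    have hE : (hermEnergy (2 * m + 1) 0 / √((2 * m + 1 : ℕ) + 1 / 2)) ^ 2 =
        ((2 * m + 1) / (2 * m + 3 / 2)) * (1 / (2 * Real.pi * Real.Wallis.W m)) := by
      have h := herm_zero_sq m
      rw [hermEnergy, energy, hermFun_sq, hermFunDeriv_sq, hermDeriv_succ, (herm_zero_right m).2,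
        div_pow, Real.sq_sqrt (by positivity), Nat.factorial_succ]
      have h2 : √(2 * Real.pi) ^ 2 = 2 * Real.pi := Real.sq_sqrt (by positivity)
      have h6 : (((2 * m : ℕ) + 1) * herm (2 * m) 0) ^ 2 / ((2 * m + 1) * (2 * m).factorial : ℕ) =
          (2 * m + 1 : ℝ) * (herm (2 * m) 0 ^ 2 / (2 * m).factorial) := by
        have := (2 * m).factorial_pos
        push_cast
        field_simp
      generalize √(2 * Real.pi) = T at h2 ⊢
      norm_num at h6 ⊢
      rw [h6, mul_pow, mul_pow, inv_pow, h2, h]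
      field_simp
      norm_num
      ring
    rw [hE, show (2 * m + 1) / 2 = m by omega]
    push_cast
    constructor
    · refine mul_le_mul_of_nonneg_right ?_ (by positivity)
      exact div_le_div_of_nonneg_left (by positivity) (by positivity) (by linarith)
    · refine mul_le_of_le_one_left (by positivity) ?_
      rw [div_le_one (by positivity)]
      norm_num

lemma tendsto_hermEnergy_zero :
    Tendsto (fun M : ℕ => hermEnergy M 0 / √(M + 1 / 2)) atTop (𝓝 (1 / Real.pi)) := by
  have hpi := Real.pi_pos
  have hdiv : Tendsto (fun M : ℕ => M / 2) atTop atTop :=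
    Nat.tendsto_div_const_atTop two_ne_zero
  have hu : Tendsto (fun M : ℕ => 1 / (2 * Real.pi * Real.Wallis.W (M / 2))) atTop
      (𝓝 (1 / (2 * Real.pi * (Real.pi / 2)))) :=
    tendsto_const_nhds.div ((Real.Wallis.tendsto_W_nhds_pi_div_two.comp hdiv).const_mul _)
      (by positivity)
  have hl := (tendsto_natCast_div_add_atTop (1 : ℝ)).mul hu
  rw [one_mul] at hl
  have hsq := tendsto_of_tendsto_of_tendsto_of_le_of_le hl hu
    (fun M => (hermEnergy_zero_bounds M).1) (fun M => (hermEnergy_zero_bounds M).2)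
  have hs := hsq.sqrt
  have e : √(1 / (2 * Real.pi * (Real.pi / 2))) = 1 / Real.pi := by
    rw [show 1 / (2 * Real.pi * (Real.pi / 2)) = (1 / Real.pi) ^ 2 by field_simp,
      Real.sqrt_sq (by positivity)]
  rw [e] at hs
  refine hs.congr fun M => Real.sqrt_sq (div_nonneg (hermEnergy_nonneg M 0) (Real.sqrt_nonneg _))

/-! ### Asymptotics in the bulk and outside -/

lemma tendsto_turning_div (d : ℕ) (s : ℝ) :
    Tendsto (fun n : ℕ => (((n + d : ℕ) : ℝ) + 1 / 2 - (2 * √(n : ℝ) * s) ^ 2 / 4) / n) atTop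
      (𝓝 (1 - s ^ 2)) := by
  have h : Tendsto (fun n : ℕ => 1 - s ^ 2 + ((d : ℝ) + 1 / 2) / n) atTop (𝓝 (1 - s ^ 2 + 0)) :=
    tendsto_const_nhds.add (tendsto_const_div_atTop_nhds_zero_nat _)
  rw [add_zero] at h
  refine h.congr' ?_
  filter_upwards [eventually_gt_atTop 0] with n hn
  have hn' : (0 : ℝ) < n := Nat.cast_pos.2 hn
  rw [mul_pow, mul_pow, Real.sq_sqrt hn'.le]
  push_cast
  field_simp
  ring

lemma tendsto_hermEnergy_div_sqrt_turning (d : ℕ) {s : ℝ} (hs0 : 0 < s) (hs1 : s < 1) :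
    Tendsto (fun n : ℕ => hermEnergy (n + d) (2 * √(n : ℝ) * s) /
      √(((n + d : ℕ) : ℝ) + 1 / 2 - (2 * √(n : ℝ) * s) ^ 2 / 4)) atTop (𝓝 (1 / Real.pi)) := by
  set q : ℕ → ℝ := fun n => ((n + d : ℕ) : ℝ) + 1 / 2 - (2 * √(n : ℝ) * s) ^ 2 / 4 with hq
  set h : ℕ → ℝ := fun n => 2 * √(n : ℝ) * s / (4 * √(q n) ^ 3) with hh
  have hs : 0 < 1 - s ^ 2 := by nlinarith
  have hqn := tendsto_turning_div d s
  have hqpos : ∀ᶠ n : ℕ in atTop, 0 < q n := by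
    filter_upwards [hqn.eventually_const_lt hs, eventually_gt_atTop 0] with n h1 hn
    exact (div_pos_iff_of_pos_right (Nat.cast_pos.2 hn)).1 h1
  -- The adiabatic error is of order `1 / n` for fixed `s < 1`.
  have h0 : Tendsto h atTop (𝓝 0) := by
    have h1 : Tendsto (fun n : ℕ => s / 2 * (1 / √(q n / n) ^ 3) * (1 / (n : ℝ))) atTop
        (𝓝 (s / 2 * (1 / √(1 - s ^ 2) ^ 3) * 0)) :=
      ((tendsto_const_nhds.div (hqn.sqrt.pow 3)
        (pow_pos (Real.sqrt_pos.2 hs) 3).ne').const_mul _).mul tendsto_one_div_atTop_nhds_zero_nat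
    rw [mul_zero] at h1
    refine h1.congr' ?_
    filter_upwards [hqpos, eventually_gt_atTop 0] with n h2 hn
    have hn' : (0 : ℝ) < n := Nat.cast_pos.2 hn
    have hr : 0 < √(n : ℝ) := Real.sqrt_pos.2 hn'
    have hr2 : (n : ℝ) = √(n : ℝ) ^ 2 := (Real.sq_sqrt hn'.le).symm
    have hw : 0 < √(q n) := Real.sqrt_pos.2 h2
    simp only [hh]
    rw [Real.sqrt_div h2.le]
    generalize √(n : ℝ) = r at hr hr2 ⊢
    rw [hr2]
    generalize √(q n) = w at hw ⊢
    field_simp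
    norm_num
  have hJ : Tendsto (fun n : ℕ => hermEnergy (n + d) 0 / √(((n + d : ℕ) : ℝ) + 1 / 2)) atTop
      (𝓝 (1 / Real.pi)) := tendsto_hermEnergy_zero.comp (tendsto_add_atTop_nat d)
  have hl : Tendsto (fun n => hermEnergy (n + d) 0 / √(((n + d : ℕ) : ℝ) + 1 / 2) *
      Real.exp (-h n) / (1 + h n / 2)) atTop (𝓝 (1 / Real.pi)) := by
    have := (hJ.mul (h0.neg.rexp)).div ((h0.div_const 2).const_add 1) (by norm_num)
    simp only [neg_zero, Real.exp_zero, zero_div, add_zero, mul_one, div_one] at this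
    exact this
  have hu : Tendsto (fun n => hermEnergy (n + d) 0 / √(((n + d : ℕ) : ℝ) + 1 / 2) *
      Real.exp (h n) / (1 - h n / 2)) atTop (𝓝 (1 / Real.pi)) := by
    have := (hJ.mul (h0.rexp)).div ((h0.div_const 2).const_sub 1) (by norm_num)
    simp only [Real.exp_zero, zero_div, sub_zero, mul_one, div_one] at this
    exact this
  have key : ∀ᶠ n : ℕ in atTop, 0 < q n ∧ h n < 1 ∧ 0 ≤ h n := by
    filter_upwards [hqpos, h0.eventually_lt_const one_pos] with n h1 h2
    exact ⟨h1, h2, by simp only [hh]; positivity⟩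
  refine tendsto_of_tendsto_of_tendsto_of_le_of_le' hl hu ?_ ?_
  · filter_upwards [key] with n hn
    rw [div_le_iff₀ (by linarith)]
    exact (energy_adiabatic (hasDerivAt_hermFun _) (hasDerivAt_hermFunDeriv _) (by positivity)
      hn.1 rfl hn.2.1.le).1
  · filter_upwards [key] with n hn
    rw [le_div_iff₀ (by linarith)]
    exact (energy_adiabatic (hasDerivAt_hermFun _) (hasDerivAt_hermFunDeriv _) (by positivity)
      hn.1 rfl hn.2.1.le).2

lemma tendsto_hermEnergy_div_sqrt (d : ℕ) {s : ℝ} (hs0 : 0 < s) (hs1 : s < 1) :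
    Tendsto (fun n : ℕ => hermEnergy (n + d) (2 * √(n : ℝ) * s) / √(n : ℝ)) atTop
      (𝓝 (√(1 - s ^ 2) / Real.pi)) := by
  have hs : 0 < 1 - s ^ 2 := by nlinarith
  have hqn := tendsto_turning_div d s
  have h := (tendsto_hermEnergy_div_sqrt_turning d hs0 hs1).mul hqn.sqrt
  rw [one_div_mul_eq_div] at h
  refine h.congr' ?_
  filter_upwards [hqn.eventually_const_lt hs, eventually_gt_atTop 0] with n h1 hn
  have hn' : (0 : ℝ) < n := Nat.cast_pos.2 hn
  have hq := (div_pos_iff_of_pos_right hn').1 h1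
  rw [Real.sqrt_div hq.le]
  have hw := Real.sqrt_pos.2 hq
  have hr := Real.sqrt_pos.2 hn'
  generalize √(((n + d : ℕ) : ℝ) + 1 / 2 - (2 * √(n : ℝ) * s) ^ 2 / 4) = w at hw ⊢
  field_simp

/-- From `q φ ^ 2 ≤ E`: `φ ^ 2` is at most `E / √q`, which converges, divided by `√q → ∞`. -/
lemma tendsto_hermFun_sq (d : ℕ) {s : ℝ} (hs0 : 0 < s) (hs1 : s < 1) :
    Tendsto (fun n : ℕ => hermFun (n + d) (2 * √(n : ℝ) * s) ^ 2) atTop (𝓝 0) := by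
  have hs : 0 < 1 - s ^ 2 := by nlinarith
  have hqn := tendsto_turning_div d s
  have hqtop : Tendsto (fun n : ℕ => ((n + d : ℕ) : ℝ) + 1 / 2 - (2 * √(n : ℝ) * s) ^ 2 / 4)
      atTop atTop := by
    refine (hqn.pos_mul_atTop hs tendsto_natCast_atTop_atTop).congr' ?_
    filter_upwards [eventually_gt_atTop 0] with n hn
    exact div_mul_cancel₀ _ (Nat.cast_pos.2 hn).ne'
  have h := (tendsto_hermEnergy_div_sqrt_turning d hs0 hs1).div_atTop
    (Real.tendsto_sqrt_atTop.comp hqtop)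
  refine squeeze_zero' (Eventually.of_forall fun n => sq_nonneg _) ?_ h
  filter_upwards [hqtop.eventually_gt_atTop 0] with n hq
  rw [Function.comp_apply, div_div, Real.mul_self_sqrt hq.le, le_div_iff₀ hq, hermEnergy, energy]
  have := sq_nonneg (hermFunDeriv (n + d) (2 * √(n : ℝ) * s))
  linarith

lemma tendsto_hermEnergy_div_sqrt_of_one_le (d : ℕ) {s : ℝ} (hs : 1 ≤ s) :
    Tendsto (fun n : ℕ => hermEnergy (n + d) (2 * √(n : ℝ) * s) / √(n : ℝ)) atTop (𝓝 0) := by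
  rw [tendsto_order]
  refine ⟨fun a ha => Eventually.of_forall fun n =>
    ha.trans_le (div_nonneg (hermEnergy_nonneg _ _) (Real.sqrt_nonneg _)), fun ε hε => ?_⟩
  -- The comparison point is `t = √(1 - δ ^ 2) < 1`, where the bulk limit equals `δ / π < ε`.
  set δ := min (1 / 2) ε with hδ
  have hδ0 : 0 < δ := lt_min (by norm_num) hε
  have hδ1 : δ ≤ 1 / 2 := min_le_left _ _
  have hδs : 0 < 1 - δ ^ 2 := by nlinarith
  have ht0 : 0 < √(1 - δ ^ 2) := Real.sqrt_pos.2 hδs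
  have ht1 : √(1 - δ ^ 2) < 1 := by
    rw [Real.sqrt_lt' one_pos]
    nlinarith
  have ht : √(1 - √(1 - δ ^ 2) ^ 2) / Real.pi < ε := by
    rw [Real.sq_sqrt hδs.le, sub_sub_cancel, Real.sqrt_sq hδ0.le, div_lt_iff₀ Real.pi_pos]
    have h1 : δ ≤ ε := min_le_right _ _
    nlinarith [Real.pi_gt_three]
  filter_upwards [(tendsto_hermEnergy_div_sqrt d ht0 ht1).eventually_lt_const ht] with n hn
  refine lt_of_le_of_lt (div_le_div_of_nonneg_right ?_ (Real.sqrt_nonneg _)) hn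
  refine energy_antitoneOn (hasDerivAt_hermFun _) (hasDerivAt_hermFunDeriv _)
    (Set.mem_Ici.2 (by positivity)) (Set.mem_Ici.2 (by positivity)) ?_
  exact mul_le_mul_of_nonneg_left (ht1.le.trans hs) (by positivity)

/-- The correction `g` is the square of the Hermite function whose index is the odd one among `N`
and `N + 1`; the bound by the sum covers both parities. -/
lemma exists_fieldDensity_eq (N : ℕ) {x : E3} (hx : x ≠ 0) :
    ∃ g, 0 ≤ g ∧ g ≤ hermFun N ‖x‖ ^ 2 + hermFun (N + 1) ‖x‖ ^ 2 ∧
      fieldDensity N x = (hermEnergy (N + 1) ‖x‖ - hermFun (N + 1) ‖x‖ ^ 2 / 2 - g / ‖x‖ ^ 2) /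
        (2 * Real.pi * ‖x‖ ^ 2) := by
  have hr : ‖x‖ ≠ 0 := norm_ne_zero_iff.2 hx
  have hpi := Real.pi_pos
  have hd : gaussDensity x = Real.exp (-‖x‖ ^ 2 / 2) / √(2 * Real.pi) / (2 * Real.pi) := by
    rw [gaussDensity, show (-(3 / 2) : ℝ) = -(1 / 2) - 1 by norm_num,
      Real.rpow_sub_one (by positivity), Real.rpow_neg (by positivity), ← Real.sqrt_eq_rpow]
    ring
  rw [fieldDensity_eq, ← sum_hermFun_sq, hd]
  simp only [hermFun_sq]
  rw [← Finset.mul_sum]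
  rcases Nat.even_or_odd' N with ⟨m, rfl | rfl⟩
  · refine ⟨hermFun (2 * m + 1) ‖x‖ ^ 2, sq_nonneg _, ?_, ?_⟩
    · rw [hermFun_sq]
      exact le_add_of_nonneg_left (by positivity)
    · rw [sum_norm_sq_orthoPoly_even hx, hermFun_sq]
      field_simp
  · refine ⟨hermFun (2 * m + 1) ‖x‖ ^ 2, sq_nonneg _, ?_, ?_⟩
    · rw [hermFun_sq]
      exact le_add_of_nonneg_right (by positivity)
    · rw [sum_norm_sq_orthoPoly_odd hx, hermFun_sq]
      field_simp

lemma norm_two_mul_sqrt_smul {u : E3} {s : ℝ} (hu : ‖u‖ = 1) (hs : 0 < s) (n : ℕ) :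
    ‖(2 * √(n : ℝ) * s) • u‖ = 2 * √(n : ℝ) * s := by
  rw [norm_smul, hu, mul_one, Real.norm_of_nonneg (by positivity)]

lemma tendsto_fieldDensity_of_lt_one (c : ℕ) {u : E3} {s : ℝ} (hu : ‖u‖ = 1) (hs0 : 0 < s)
    (hs1 : s < 1) :
    Tendsto (fun n : ℕ => 2 * √(n : ℝ) * fieldDensity (n + c) ((2 * √(n : ℝ) * s) • u)) atTop
      (𝓝 (1 / (2 * Real.pi) ^ 2 * (√(1 - s ^ 2) / s ^ 2))) := by
  have hpi := Real.pi_pos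
  have hx : ∀ n : ℕ, 0 < n → (2 * √(n : ℝ) * s) • u ≠ 0 := fun n hn => by
    rw [← norm_ne_zero_iff, norm_two_mul_sqrt_smul hu hs0]
    have := Real.sqrt_pos.2 (Nat.cast_pos (α := ℝ).2 hn)
    positivity
  have hex : ∀ n : ℕ, ∃ g : ℝ, 0 < n → 0 ≤ g ∧
      g ≤ hermFun (n + c) (2 * √(n : ℝ) * s) ^ 2 + hermFun (n + (c + 1)) (2 * √(n : ℝ) * s) ^ 2 ∧
      fieldDensity (n + c) ((2 * √(n : ℝ) * s) • u) =
        (hermEnergy (n + (c + 1)) (2 * √(n : ℝ) * s) -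
          hermFun (n + (c + 1)) (2 * √(n : ℝ) * s) ^ 2 / 2 - g / (2 * √(n : ℝ) * s) ^ 2) /
        (2 * Real.pi * (2 * √(n : ℝ) * s) ^ 2) := by
    intro n
    rcases Nat.eq_zero_or_pos n with rfl | hn
    -- For `n = 0` the point is the origin, where the representation is not available.
    · exact ⟨0, fun h => absurd h (lt_irrefl 0)⟩
    · obtain ⟨g, hg⟩ := exists_fieldDensity_eq (n + c) (hx n hn)
      rw [norm_two_mul_sqrt_smul hu hs0] at hg
      exact ⟨g, fun _ => hg⟩
  choose g hg using hex
  have hg0 : Tendsto g atTop (𝓝 0) := by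
    have h := (tendsto_hermFun_sq c hs0 hs1).add (tendsto_hermFun_sq (c + 1) hs0 hs1)
    rw [add_zero] at h
    refine squeeze_zero' ?_ ?_ h
    · filter_upwards [eventually_gt_atTop 0] with n hn using (hg n hn).1
    · filter_upwards [eventually_gt_atTop 0] with n hn using (hg n hn).2.1
  have hsqrt : Tendsto (fun n : ℕ => √(n : ℝ)) atTop atTop :=
    Real.tendsto_sqrt_atTop.comp tendsto_natCast_atTop_atTop
  have hcorr : Tendsto (fun n : ℕ => g n / (4 * s ^ 2) * (1 / (n : ℝ)) / √(n : ℝ)) atTop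
      (𝓝 0) :=
    ((hg0.div_const _).mul tendsto_one_div_atTop_nhds_zero_nat).div_atTop hsqrt
  have hsq := ((tendsto_hermFun_sq (c + 1) hs0 hs1).div_const 2).div_atTop hsqrt
  have hmain := (((tendsto_hermEnergy_div_sqrt (c + 1) hs0 hs1).sub hsq).sub hcorr).const_mul
    (1 / (4 * Real.pi * s ^ 2))
  rw [sub_zero, sub_zero] at hmain
  rw [show 1 / (2 * Real.pi) ^ 2 * (√(1 - s ^ 2) / s ^ 2) =
    1 / (4 * Real.pi * s ^ 2) * (√(1 - s ^ 2) / Real.pi) by field_simp; ring]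
  refine hmain.congr' ?_
  filter_upwards [eventually_gt_atTop 0] with n hn
  have hn' : (0 : ℝ) < n := Nat.cast_pos.2 hn
  have hr : 0 < √(n : ℝ) := Real.sqrt_pos.2 hn'
  have hr2 : (n : ℝ) = √(n : ℝ) ^ 2 := (Real.sq_sqrt hn'.le).symm
  rw [(hg n hn).2.2]
  generalize hermEnergy (n + (c + 1)) (2 * √(n : ℝ) * s) = e
  generalize hermFun (n + (c + 1)) (2 * √(n : ℝ) * s) = f
  generalize g n = g
  generalize √(n : ℝ) = r at hr hr2 ⊢
  rw [hr2]
  field_simp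
  ring

lemma tendsto_fieldDensity_of_one_lt (c : ℕ) {u : E3} {s : ℝ} (hu : ‖u‖ = 1) (hs : 1 < s) :
    Tendsto (fun n : ℕ => 2 * √(n : ℝ) * fieldDensity (n + c) ((2 * √(n : ℝ) * s) • u)) atTop
      (𝓝 0) := by
  have hpi := Real.pi_pos
  have hs0 : 0 < s := one_pos.trans hs
  have h := (tendsto_hermEnergy_div_sqrt_of_one_le (c + 1) hs.le).const_mul
    (1 / (4 * Real.pi * s ^ 2))
  rw [mul_zero] at h
  refine squeeze_zero' (Eventually.of_forall fun n =>
    mul_nonneg (by positivity) (fieldDensity_nonneg _ _)) ?_ h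
  filter_upwards [eventually_gt_atTop 0] with n hn
  have hn' : (0 : ℝ) < n := Nat.cast_pos.2 hn
  have hr : 0 < √(n : ℝ) := Real.sqrt_pos.2 hn'
  have hx : (2 * √(n : ℝ) * s) • u ≠ 0 := by
    rw [← norm_ne_zero_iff, norm_two_mul_sqrt_smul hu hs0]
    positivity
  obtain ⟨g, hg0, -, hg⟩ := exists_fieldDensity_eq (n + c) hx
  rw [norm_two_mul_sqrt_smul hu hs0] at hg
  have hle : fieldDensity (n + c) ((2 * √(n : ℝ) * s) • u) ≤
      hermEnergy (n + c + 1) (2 * √(n : ℝ) * s) / (2 * Real.pi * (2 * √(n : ℝ) * s) ^ 2) := by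
    rw [hg]
    refine div_le_div_of_nonneg_right ?_ (by positivity)
    have h1 : 0 ≤ g / (2 * √(n : ℝ) * s) ^ 2 := by positivity
    have h2 := sq_nonneg (hermFun (n + c + 1) (2 * √(n : ℝ) * s))
    linarith
  refine (mul_le_mul_of_nonneg_left hle (by positivity)).trans_eq ?_
  rw [← add_assoc]
  generalize hermEnergy (n + c + 1) (2 * √(n : ℝ) * s) = e
  field_simp
  ring

end

end GinibreThree

theorem mainTheorem7 (c : ℕ) (hc : c = 0 ∨ c = 1) :
    (∀ n : ℕ, Continuous (GinibreThree.fieldDensity (n + c)) ∧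
      ∀ (Ω : Type*) [MeasurableSpace Ω] (P : Measure Ω) [IsProbabilityMeasure P]
        (X : Ω → Measure GinibreThree.E3),
        GinibreThree.IsDeterminantalField P X GinibreThree.gaussMeasure
            (GinibreThree.kernel (n + c)) →
        ∀ ρ : GinibreThree.E3 → ℝ, Continuous ρ →
          (GinibreThree.IsOnePointDensity P X ρ ↔
            ρ = GinibreThree.fieldDensity (n + c))) ∧
    ∀ (u : GinibreThree.E3) (s : ℝ), ‖u‖ = 1 → 0 < s →
      (s < 1 → Tendsto
        (fun n : ℕ => 2 * √(n : ℝ) *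
          GinibreThree.fieldDensity (n + c) ((2 * √(n : ℝ) * s) • u))
        atTop (𝓝 (1 / (2 * Real.pi) ^ 2 * (√(1 - s ^ 2) / s ^ 2)))) ∧
      (1 < s → Tendsto
        (fun n : ℕ => 2 * √(n : ℝ) *
          GinibreThree.fieldDensity (n + c) ((2 * √(n : ℝ) * s) • u))
        atTop (𝓝 0)) := by
  refine ⟨fun n => ⟨GinibreThree.continuous_fieldDensity _, ?_⟩, fun u s hu hs =>
    ⟨GinibreThree.tendsto_fieldDensity_of_lt_one c hu hs,
      GinibreThree.tendsto_fieldDensity_of_one_lt c hu⟩⟩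
  intro Ω _ P _ X hX ρ hρ
  have h := GinibreThree.isOnePointDensity_of_isDeterminantalField hX
  refine ⟨fun h' => h'.unique hρ (GinibreThree.continuous_fieldDensity _) h, ?_⟩
  rintro rfl
  exact h
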